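/- Let $\kappa>0$ (wave number) and $R>0$. Axisymmetric functions on the ball of radius $R$ are written $f(\rho,t)$ with $\rho\in[0,R]$, $t=\cos\theta\in[-1,1]$; $\|f\|_\infty$ is the supremum over $[0,R]\times[-1,1]$. Let $P_n$ be the Legendre polynomials, $f_n(\rho)=\frac{2n+1}{2}\int_{-1}^{1}f(\rho,t)P_n(t)\,dt$ the Legendre coefficients of $f$, and $f^F(\rho,t)=\sum_{n=0}^{F}f_n(\rho)P_n(t)$. Let $j_n$ and $h_n^{(1)}=j_n+iy_n$ be the spherical Bessel and Hankel functions. For a bounded measurable contrast $m$ (complex-valued, $m=1-n^2$ with refractive index $n$, vanishing outside the ball of radius $R$) and bounded measurable $w$ put $$(K_nw)(\tilde\rho)=-(2n+1)\kappa^3\int_0^R h_n^{(1)}(\kappa\max(\tilde\rho,\rho))\,j_n(\kappa\min(\tilde\rho,\rho))\Big(\int_0^\pi w(\rho,\cos\theta)\,m(\rho,\cos\theta)\,P_n(\cos\theta)\sin\theta\,d\theta\Big)\rho^2\,d\rho,$$ $$(K^Fw)(\rho,t)=\sum_{n=0}^{F}(K_nw)(\rho)P_n(t).$$ Let $u^i$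 be a bounded measurable incident field, and let $u$ be a bounded measurable solution of the axisymmetric Lippmann--Schwinger equation $$u_n(\rho)=u^i_n(\rho)+\tfrac{i}{2}(K_nu)(\rho),\qquad 0\le\rho\le R,\ n=0,1,2,\dots$$ For every $F$ let $v^F$ be a bounded measurable solution of the truncated equation $v^F=(u^i)^F+\frac i2K^Fv^F$ on $[0,R]\times[-1,1]$. Assume that there is a constant $B$ such that, for all $F$, the operator $I-\frac i2K^F$ is invertible on the bounded measurable functions on $[0,R]\times[-1,1]$ with $\|(I-\frac i2K^F)^{-1}\|_\infty\le B$. Let $k\ge0$ be an integer and $\alpha>0$ real, with $\alpha<1$ if $k\le1$, and suppose that, uniformly in $\rho\in[0,R]$, $$|m_l(\rho)|=O\big(l^{-(k+\alpha)}\big),\qquad |u_s(\rho)|=O\big(s^{-(k+2+\alpha)}\big)\qquad(l,s\ge1).$$ Then, as $F\to\infty$, $$\varepsilon_F:=\|u^F-v^F\|_\infty=\begin{cases}O\big(F^{-(k+2.5+\alpha+\min(1.5,\,k-2+\alpha))}\big)&\text{if }k\ge3,\\ O\big(\log F\cdot F^{-(4.5+\alpha+\min(1,\,.5+\alpha))}\big)&\text{if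 }k=2,\\ O\big(F^{-(3+2\alpha)}\big)&\text{if }k=1,\\ O\big(F^{-(1+2\alpha)}\big)&\text{if }k=0.\end{cases}$$ -/

import Mathlib

open Filter Set MeasureTheory
open scoped ENNReal NNReal

noncomputable section

namespace AxiLS

/-- The Legendre polynomial `P_n`, by Rodrigues' formula
`P_n(t) = (2 ^ n n!)⁻¹ (d/dt)^n (t ^ 2 - 1) ^ n`. -/
def legendrePoly (n : ℕ) : Polynomial ℝ :=
  Polynomial.C ((1 : ℝ) / (2 ^ n * (n.factorial : ℝ))) *
    (Polynomial.derivative^[n] ((Polynomial.X ^ 2 - 1) ^ n))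

/-- The value `P_n(t)`. -/
def P (n : ℕ) (t : ℝ) : ℝ := (legendrePoly n).eval t

/-- The spherical Bessel function of the first kind,
`j_n(x) = x ^ n / (1·3·5⋯(2n+1)) · ∑_p (-x²/2) ^ p / (p! (2n+3)(2n+5)⋯(2n+2p+1))`. -/
def sphJ (n : ℕ) (x : ℝ) : ℝ :=
  x ^ n / (∏ q ∈ Finset.range (n + 1), (2 * (q : ℝ) + 1)) *
    ∑' p : ℕ, (-(x ^ 2 / 2)) ^ p /
      ((p.factorial : ℝ) * ∏ q ∈ Finset.range p, (2 * (n : ℝ) + 2 * (q : ℝ) + 3))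

/-- The spherical Bessel function of the second kind,
`y_n(x) = -(1·3·5⋯(2n-1)) / x ^ (n+1) · ∑_p (-x²/2) ^ p / (p! (1-2n)(3-2n)⋯(2p-1-2n))`,
for `x > 0`. -/
def sphY (n : ℕ) (x : ℝ) : ℝ :=
  -((∏ q ∈ Finset.range n, (2 * (q : ℝ) + 1)) / x ^ (n + 1)) *
    ∑' p : ℕ, (-(x ^ 2 / 2)) ^ p /
      ((p.factorial : ℝ) * ∏ q ∈ Finset.range p, (2 * (q : ℝ) + 1 - 2 * (n : ℝ)))

/-- The spherical Hankel function of the first kind, `h_n^{(1)} = j_n + i y_n`. -/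
def sphH (n : ℕ) (x : ℝ) : ℂ := (sphJ n x : ℂ) + Complex.I * (sphY n x : ℂ)

/-!
An axisymmetric function on the ball of radius `R` is written `f ρ t`, where `ρ ∈ [0, R]` is
the distance to the origin and `t = cos θ ∈ [-1, 1]`.
-/

/-- The supremum norm of an axisymmetric function on the ball of radius `R`; it is `⊤` exactly
if the function is unbounded there. -/
def supNorm (R : ℝ) (f : ℝ → ℝ → ℂ) : ℝ≥0∞ :=
  ⨆ ρ ∈ Icc (0 : ℝ) R, ⨆ t ∈ Icc (-1 : ℝ) 1, ‖f ρ t‖ₑ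

/-- Measurable axisymmetric functions that are bounded on the ball of radius `R`. -/
def BddMeas (R : ℝ) (f : ℝ → ℝ → ℂ) : Prop :=
  Measurable (Function.uncurry f) ∧ supNorm R f < ⊤

/-- The `n`-th Legendre coefficient of `f` at radius `ρ`:
`f_n(ρ) = (2n+1)/2 · ∫_{-1}^1 f(ρ, t) P_n(t) dt`. -/
def coeff (f : ℝ → ℝ → ℂ) (n : ℕ) (ρ : ℝ) : ℂ :=
  ((2 * (n : ℂ) + 1) / 2) * ∫ t in (-1 : ℝ)..1, f ρ t * (P n t : ℂ)

/-- The truncated Legendre series `f^F(ρ, t) = ∑_{n=0}^F f_n(ρ) P_n(t)`. -/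
def trunc (F : ℕ) (f : ℝ → ℝ → ℂ) (ρ t : ℝ) : ℂ :=
  ∑ n ∈ Finset.range (F + 1), coeff f n ρ * (P n t : ℂ)

/-- The angular integral, in the variable `t = cos θ`:
`I_n(ρ) = ∫_0^π w(ρ, cos θ) m(ρ, cos θ) P_n(cos θ) sin θ dθ`. -/
def angInt (m w : ℝ → ℝ → ℂ) (n : ℕ) (ρ : ℝ) : ℂ :=
  ∫ t in (-1 : ℝ)..1, w ρ t * m ρ t * (P n t : ℂ)

/-- `(K_n w)(a) = -(2n+1) κ³ ∫_0^R h_n(κ ρ_>) j_n(κ ρ_<) I_n(ρ) ρ² dρ`, where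
`ρ_> = max(a, ρ)` and `ρ_< = min(a, ρ)`. -/
def opKn (κ R : ℝ) (m : ℝ → ℝ → ℂ) (n : ℕ) (w : ℝ → ℝ → ℂ) (a : ℝ) : ℂ :=
  -(2 * (n : ℂ) + 1) * (κ : ℂ) ^ 3 *
    ∫ ρ in (0 : ℝ)..R, sphH n (κ * max a ρ) * (sphJ n (κ * min a ρ) : ℂ) *
      angInt m w n ρ * (ρ : ℂ) ^ 2

/-- `(K^F w)(ρ, t) = ∑_{n=0}^F (K_n w)(ρ) P_n(t)`. -/
def opK (κ R : ℝ) (m : ℝ → ℝ → ℂ) (F : ℕ) (w : ℝ → ℝ → ℂ) (ρ t : ℝ) : ℂ :=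
  ∑ n ∈ Finset.range (F + 1), opKn κ R m n w ρ * (P n t : ℂ)

/-- The operator `I - (i/2) K^F`. -/
def opA (κ R : ℝ) (m : ℝ → ℝ → ℂ) (F : ℕ) (w : ℝ → ℝ → ℂ) (ρ t : ℝ) : ℂ :=
  w ρ t - Complex.I / 2 * opK κ R m F w ρ t

/-- `I - (i/2) K^F` is invertible on the bounded measurable functions with the supremum norm,
and `‖(I - (i/2) K^F)⁻¹‖ ≤ B`: it is onto, and `‖w‖ ≤ B ‖(I - (i/2) K^F) w‖` for all `w`
(which contains injectivity). -/
def InvBound (κ R : ℝ) (m : ℝ → ℝ → ℂ) (F : ℕ) (B : ℝ≥0) : Prop :=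
  (∀ g, BddMeas R g → ∃ w, BddMeas R w ∧
    ∀ ρ ∈ Icc (0 : ℝ) R, ∀ t ∈ Icc (-1 : ℝ) 1, opA κ R m F w ρ t = g ρ t) ∧
  ∀ w, BddMeas R w → supNorm R w ≤ (B : ℝ≥0∞) * supNorm R (opA κ R m F w)

/-- `u` is a bounded solution of the axisymmetric Lippmann-Schwinger equation with incident
field `ui`: `u_n = ui_n + (i/2) K_n u` on `[0, R]` for every `n`. -/
def IsExactSolution (κ R : ℝ) (m ui u : ℝ → ℝ → ℂ) : Prop :=
  BddMeas R u ∧ ∀ n : ℕ, ∀ ρ ∈ Icc (0 : ℝ) R,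
    coeff u n ρ = coeff ui n ρ + Complex.I / 2 * opKn κ R m n u ρ

/-- `v` is a bounded solution of the truncated equation `v = ui^F + (i/2) K^F v`. -/
def IsTruncatedSolution (κ R : ℝ) (m ui : ℝ → ℝ → ℂ) (F : ℕ) (v : ℝ → ℝ → ℂ) : Prop :=
  BddMeas R v ∧ ∀ ρ ∈ Icc (0 : ℝ) R, ∀ t ∈ Icc (-1 : ℝ) 1,
    v ρ t = trunc F ui ρ t + Complex.I / 2 * opK κ R m F v ρ t

/-- The Legendre coefficients of `f` decay like `O(n ^ (-s))`, uniformly on `[0, R]`. -/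
def CoeffDecay (R : ℝ) (f : ℝ → ℝ → ℂ) (s : ℝ) : Prop :=
  ∃ C : ℝ, ∀ n : ℕ, 1 ≤ n → ∀ ρ ∈ Icc (0 : ℝ) R, ‖coeff f n ρ‖ ≤ C * (n : ℝ) ^ (-s)

/-- `‖e F‖_∞ = O(r F)` as `F → ∞`. -/
def SupNormBigO (R : ℝ) (e : ℕ → ℝ → ℝ → ℂ) (r : ℕ → ℝ) : Prop :=
  ∃ C : ℝ, ∀ᶠ F in atTop, supNorm R (e F) ≤ ENNReal.ofReal (C * r F)

end AxiLS

end

/-! Write `p = k + α` and `e = u^F - v^F`. Taking the orders `n ≤ F` of the exact equation and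
subtracting the truncated one gives `(I - (i/2) K^F) e = (i/2) K^F (u - u^F)` (`opA_trunc_sub`). The
uniform bound on the inverse therefore reduces everything to the size of `K^F` on the Legendre tail
`u - u^F`.

Two estimates control that size. Radially, the power series of `j_n` and `y_n` give `(2n+1) |h_n(y)
j_n(x)| ≤ C x^n / y^(n+1)` for `x ≤ y` in a bounded range, and integration in `ρ` gains a factor
`1/(n+1)` uniformly in the outer radius (`norm_opKn_le`). Angularly, the coefficients of `u` are
summable, so the tail integrates term by term and produces `∑_{s>F} u_s ∫ P_s m P_n`. The product
`P_s P_n` is a combination of the `P_l` whose triple integrals vanish for `l < s - n` and are at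
most `2/s`, so order `n` costs at most a constant times `∑_{s>F} s^(-(p+3)) ∑_{s-n ≤ l ≤ s+n}
l^(-p)` (`norm_angInt_sub_trunc_le`).

Splitting the inner sum at `l = F/2`, exchanging sums, and summing over `n ≤ F` with weight
`1/(n+1)` leaves `F^(-(2p+1)) + F^(-(p+4)) ∑_{l ≤ F} l^(2-p)` up to a constant
(`exists_supNorm_error_le`). For `k ≤ 1` the last sum is `O(F^(3-p))` and both terms have the same
order; for `k ≥ 3` it is bounded; for `k = 2` it is `O(F^(1-β))` with `β = min(α, 1/2)`, which
already gives the required power without the logarithm. -/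

noncomputable section

namespace AxiLS

/-! ### Legendre polynomials: orthogonality, uniform bound, triple integrals -/

section Legendre

open Polynomial

/-- Integration of polynomials over `[-1, 1]`, as a linear functional. -/
def polyInt : ℝ[X] →ₗ[ℝ] ℝ where
  toFun p := ∫ t in (-1 : ℝ)..1, p.eval t
  map_add' p q := by
    simp only [eval_add]
    exact intervalIntegral.integral_add (p.continuous.intervalIntegrable _ _)
      (q.continuous.intervalIntegrable _ _)
  map_smul' c p := by
    simp

theorem polyInt_apply (p : ℝ[X]) : polyInt p = ∫ t in (-1 : ℝ)..1, p.eval t := rfl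

theorem polyInt_derivative (p : ℝ[X]) : polyInt (derivative p) = p.eval 1 - p.eval (-1) := by
  rw [polyInt_apply]
  exact intervalIntegral.integral_eq_sub_of_hasDerivAt (fun x _ => p.hasDerivAt x)
    ((derivative p).continuous.intervalIntegrable _ _)

theorem polyInt_C_mul (c : ℝ) (p : ℝ[X]) : polyInt (C c * p) = c * polyInt p := by
  rw [← smul_eq_C_mul, map_smul, smul_eq_mul]

/-- Iterated integration by parts against a polynomial vanishing to order `n` at `±1`. -/
theorem polyInt_iterate_derivative_mul (n : ℕ) (w q : ℝ[X]) (hw : (X ^ 2 - 1) ^ n ∣ w) :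
    polyInt (derivative^[n] w * q) = (-1) ^ n * polyInt (w * derivative^[n] q) := by
  induction n generalizing w with
  | zero => simp
  | succ n ih =>
    have hd : (X ^ 2 - 1) ^ n ∣ derivative w := by
      simpa using pow_sub_dvd_iterate_derivative_of_pow_dvd 1 hw
    rw [Function.iterate_succ_apply, ih _ hd, Function.iterate_succ_apply']
    have h1 := polyInt_derivative (w * derivative^[n] q)
    obtain ⟨r, rfl⟩ := hw
    rw [derivative_mul, map_add] at h1
    simp only [eval_mul, eval_pow, eval_sub, eval_X, eval_one, one_pow, sub_self, neg_sq,
      ne_eq, Nat.add_eq_zero_iff, one_ne_zero, and_false, not_false_eq_true, zero_pow,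
      zero_mul] at h1
    rw [pow_succ (-1 : ℝ)]
    linear_combination (-1) ^ n * h1

theorem natDegree_legendrePoly_le (n : ℕ) : (legendrePoly n).natDegree ≤ n := by
  unfold legendrePoly
  refine (natDegree_C_mul_le _ _).trans ((natDegree_iterate_derivative _ _).trans ?_)
  have h : ((X ^ 2 - 1 : ℝ[X]) ^ n).natDegree ≤ n * 2 := by
    refine natDegree_pow_le.trans (Nat.mul_le_mul_left _ ?_)
    compute_degree
  omega

theorem polyInt_legendrePoly_mul_eq_zero (n : ℕ) (q : ℝ[X]) (hq : q.degree < n) :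
    polyInt (legendrePoly n * q) = 0 := by
  unfold legendrePoly
  rw [mul_assoc, polyInt_C_mul, polyInt_iterate_derivative_mul _ _ _ dvd_rfl,
    iterate_derivative_eq_zero_of_degree_lt hq]
  simp

/-- Around `r = ±1` the polynomial `(x^2-1)^n` is `(x-r)^n (x-r+2r)^n`. Its `n`-th derivative at `r`
is `n!` times the Taylor coefficient of order `n`, namely `(2r)^n`. -/
theorem legendrePoly_eval_of_sq_eq_one (n : ℕ) (r : ℝ) (hr : r ^ 2 = 1) :
    (legendrePoly n).eval r = r ^ n := by
  have h1 : taylor r ((X ^ 2 - 1 : ℝ[X]) ^ n) = X ^ n * (X + C (2 * r)) ^ n := by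
    rw [taylor_pow, ← mul_pow]
    congr 1
    simp only [map_sub, taylor_X_pow, taylor_one]
    have : (C r : ℝ[X]) ^ 2 = 1 := by rw [← C_pow, hr, C_1]
    simp only [C_mul, map_ofNat, map_one]
    linear_combination this
  have h2 : (derivative^[n] ((X ^ 2 - 1 : ℝ[X]) ^ n)).eval r = n.factorial * (2 * r) ^ n := by
    rw [← factorial_smul_hasseDeriv]
    simp only [LinearMap.smul_apply, eval_smul, ← taylor_coeff, h1]
    have h3 := coeff_X_pow_mul ((X + C (2 * r) : ℝ[X]) ^ n) n 0
    rw [zero_add] at h3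
    rw [h3, coeff_zero_eq_eval_zero]
    simp
  have hf : (n.factorial : ℝ) ≠ 0 := by positivity
  unfold legendrePoly
  rw [eval_mul, eval_C, h2, mul_pow]
  field_simp

/-- Integrate `(x P_n^2)'`: the boundary terms give 2. The derivative equals `(2n+1) P_n^2` plus `2
P_n (x P_n' - n P_n)`, and the second factor has degree below `n`, hence is orthogonal to `P_n`. -/
theorem polyInt_legendrePoly_sq (n : ℕ) :
    polyInt (legendrePoly n * legendrePoly n) = 2 / (2 * n + 1) := by
  set p := legendrePoly n with hp
  have h1 := polyInt_derivative (X * (p * p))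
  have e1 : p.eval 1 = 1 := by simpa using legendrePoly_eval_of_sq_eq_one n 1 (by norm_num)
  have e2 : p.eval (-1) * p.eval (-1) = 1 := by
    rw [legendrePoly_eval_of_sq_eq_one n (-1) (by norm_num), ← mul_pow]
    norm_num
  have h2 : (X * derivative p - C (n : ℝ) * p).degree < (n : WithBot ℕ) := by
    rw [degree_lt_iff_coeff_zero]
    intro m hm
    have hd := natDegree_legendrePoly_le n
    rw [← hp] at hd
    rcases m with _ | m
    · have : n = 0 := by omega
      subst this
      simp
    · simp only [coeff_sub, coeff_X_mul, coeff_derivative, coeff_C_mul]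
      rcases hm.eq_or_lt with h | h
      · have : (n : ℝ) = m + 1 := by exact_mod_cast h
        rw [this]; ring
      · rw [coeff_eq_zero_of_natDegree_lt (by omega : p.natDegree < m + 1)]
        simp
  have h3 := polyInt_legendrePoly_mul_eq_zero n _ h2
  rw [← hp] at h3
  have h4 : derivative (X * (p * p)) =
      C (2 * n + 1 : ℝ) * (p * p) + C 2 * (p * (X * derivative p - C (n : ℝ) * p)) := by
    simp only [derivative_mul, derivative_X, C_add, C_mul, C_1]
    have : (C 2 : ℝ[X]) = 2 := rfl
    rw [this]
    ring
  rw [h4, map_add, polyInt_C_mul, polyInt_C_mul, h3] at h1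
  simp only [eval_mul, eval_X, e1, e2] at h1
  have : (2 * (n : ℝ) + 1) ≠ 0 := by positivity
  field_simp
  linarith

theorem coeff_legendrePoly_ne_zero (n : ℕ) : (legendrePoly n).coeff n ≠ 0 := by
  intro h
  have h1 : (legendrePoly n).degree < n := by
    rw [degree_lt_iff_coeff_zero]
    intro m hm
    rcases hm.eq_or_lt with rfl | hm
    · exact h
    · exact coeff_eq_zero_of_natDegree_lt ((natDegree_legendrePoly_le n).trans_lt hm)
  have h2 := polyInt_legendrePoly_mul_eq_zero n _ h1
  rw [polyInt_legendrePoly_sq] at h2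
  have : (0 : ℝ) < 2 / (2 * n + 1) := by positivity
  linarith

theorem degree_legendrePoly_lt {l n : ℕ} (h : l < n) : (legendrePoly l).degree < n :=
  degree_le_natDegree.trans_lt
    (by exact_mod_cast (natDegree_legendrePoly_le l).trans_lt h)

theorem polyInt_legendrePoly_mul_of_ne {l n : ℕ} (h : l ≠ n) :
    polyInt (legendrePoly l * legendrePoly n) = 0 := by
  rcases lt_or_gt_of_ne h with h | h
  · rw [mul_comm]
    exact polyInt_legendrePoly_mul_eq_zero _ _ (degree_legendrePoly_lt h)
  · exact polyInt_legendrePoly_mul_eq_zero _ _ (degree_legendrePoly_lt h)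

/-- The finite Legendre expansion of a polynomial. -/
theorem eq_sum_legendrePoly (N : ℕ) (q : ℝ[X]) (hq : q.degree < N) :
    q = ∑ l ∈ Finset.range N,
      C ((2 * (l : ℝ) + 1) / 2 * polyInt (q * legendrePoly l)) * legendrePoly l := by
  induction N generalizing q with
  | zero =>
    have : q = 0 := by
      rw [← degree_eq_bot]
      simpa using hq
    simp [this]
  | succ N ih =>
    -- Chosen to cancel the coefficient of degree `N`; orthogonality later identifies it with the
    -- Fourier coefficient.
    set c := q.coeff N / (legendrePoly N).coeff N with hc
    have h1 : (q - C c * legendrePoly N).degree < N := by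
      rw [degree_lt_iff_coeff_zero] at hq ⊢
      intro m hm
      rcases hm.eq_or_lt with rfl | hm
      · rw [coeff_sub, coeff_C_mul, hc, div_mul_cancel₀ _ (coeff_legendrePoly_ne_zero N), sub_self]
      · rw [coeff_sub, coeff_C_mul, hq m hm,
          coeff_eq_zero_of_natDegree_lt ((natDegree_legendrePoly_le N).trans_lt hm)]
        simp
    have h2 := ih _ h1
    have h3 : ∀ l ∈ Finset.range N, polyInt ((q - C c * legendrePoly N) * legendrePoly l) =
        polyInt (q * legendrePoly l) := by
      intro l hl
      rw [sub_mul, map_sub, mul_assoc, polyInt_C_mul, polyInt_legendrePoly_mul_of_ne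
        (Finset.mem_range.mp hl).ne']
      simp
    have h4 : (2 * (N : ℝ) + 1) / 2 * polyInt (q * legendrePoly N) = c := by
      have h5 := polyInt_legendrePoly_mul_eq_zero N _ h1
      rw [mul_comm, sub_mul, map_sub, mul_assoc, polyInt_C_mul, polyInt_legendrePoly_sq,
        sub_eq_zero] at h5
      rw [h5]
      have : (2 * (N : ℝ) + 1) ≠ 0 := by positivity
      field_simp
    rw [Finset.sum_range_succ, h4]
    rw [Finset.sum_congr rfl fun l hl => by rw [h3 l hl]] at h2
    rw [← h2]
    ring

/-- With `w = (x^2-1)^n` one has `(x^2-1) w' = 2n x w`; differentiating `n+1` times by the Leibniz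
rule gives Legendre's equation for the `n`-th derivative of `w`. -/
theorem legendrePoly_ode (n : ℕ) :
    (X ^ 2 - 1) * derivative (derivative (legendrePoly n)) +
      2 * X * derivative (legendrePoly n) =
      C ((n : ℝ) * (n + 1)) * legendrePoly n := by
  set w : ℝ[X] := (X ^ 2 - 1) ^ n with hw
  have h1 : derivative w * X * X - derivative w = C (2 * n : ℝ) * (w * X) := by
    rcases n with _ | n
    · simp [hw]
    · rw [hw, derivative_pow]
      simp only [derivative_sub, derivative_X_pow, derivative_one, C_mul, map_natCast]
      have : (C 2 : ℝ[X]) = 2 := rfl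
      rw [this]
      simp only [Nat.add_sub_cancel, pow_succ]
      push_cast
      ring
  have h2 := congrArg (fun p => derivative^[n + 1] p) h1
  simp only [iterate_derivative_sub, iterate_derivative_C_mul, iterate_derivative_mul_X,
    ← Function.iterate_succ_apply, Nat.add_sub_cancel] at h2
  have e1 : derivative^[n + 1 + 1] w = derivative (derivative (derivative^[n] w)) := by
    rw [Function.iterate_succ_apply', Function.iterate_succ_apply']
  have e2 : derivative^[n + 1] w = derivative (derivative^[n] w) := by
    rw [Function.iterate_succ_apply']
  have e3 : n • derivative^[n - 1 + 1] w = n • derivative^[n] w := by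
    rcases n with _ | n <;> simp
  simp only [Nat.succ_eq_add_one, e1, e2, e3] at h2
  set U := derivative^[n] w with hU
  have h3 : (X ^ 2 - 1) * derivative (derivative U) + 2 * X * derivative U =
      C ((n : ℝ) * (n + 1)) * U := by
    simp only [nsmul_eq_mul, C_mul, C_add, C_1, map_natCast] at h2 ⊢
    have : (C 2 : ℝ[X]) = 2 := rfl
    rw [this] at h2
    push_cast at h2
    linear_combination h2
  have h4 : legendrePoly n = C ((1 : ℝ) / (2 ^ n * (n.factorial : ℝ))) * U := rfl
  rw [h4]
  simp only [derivative_C_mul]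
  linear_combination C ((1 : ℝ) / (2 ^ n * (n.factorial : ℝ))) * h3

theorem legendrePoly_zero : legendrePoly 0 = 1 := by
  simp [legendrePoly]

/-- Consider `g = n(n+1) P_n^2 + (1-x^2) P_n'^2`. Legendre's equation yields `g' = 2x P_n'^2`, so
`g` is largest on `[-1,1]` at the endpoints, where it equals `n(n+1)`. The order `n = 0` is separate
because `n(n+1)` is divided out. -/
theorem abs_P_le_one (n : ℕ) {t : ℝ} (ht : t ∈ Icc (-1 : ℝ) 1) : |P n t| ≤ 1 := by
  rcases Nat.eq_zero_or_pos n with rfl | hn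
  · simp [P, legendrePoly_zero]
  set p := legendrePoly n with hp
  set g : ℝ[X] := C ((n : ℝ) * (n + 1)) * p ^ 2 + (1 - X ^ 2) * derivative p ^ 2 with hg
  have hgd : derivative g = 2 * X * derivative p ^ 2 := by
    have h := legendrePoly_ode n
    rw [← hp] at h
    simp only [hg, derivative_add, derivative_mul, derivative_C, derivative_pow, derivative_sub,
      derivative_one, derivative_X, map_natCast]
    push_cast
    linear_combination (-2) * derivative p * h
  have hge : ∀ x, deriv (fun y => g.eval y) x = 2 * x * (derivative p).eval x ^ 2 := by
    intro x
    rw [Polynomial.deriv, hgd]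
    simp
  have hend : ∀ r : ℝ, r ^ 2 = 1 → g.eval r = (n : ℝ) * (n + 1) := by
    intro r hr
    simp only [hg, eval_add, eval_mul, eval_C, eval_pow, eval_sub, eval_one, eval_X, hr, hp,
      legendrePoly_eval_of_sq_eq_one n r hr]
    rw [← pow_mul, mul_comm n 2, pow_mul, hr]
    simp
  have hle : g.eval t ≤ (n : ℝ) * (n + 1) := by
    rcases le_total 0 t with h | h
    · rw [← hend 1 (by norm_num)]
      refine monotoneOn_of_deriv_nonneg (f := fun y => g.eval y) (convex_Icc (0 : ℝ) 1)
        g.continuous.continuousOn g.differentiable.differentiableOn ?_ ⟨h, ht.2⟩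
        ⟨zero_le_one, le_rfl⟩ ht.2
      intro x hx
      rw [interior_Icc] at hx
      rw [hge]
      have := hx.1
      positivity
    · rw [← hend (-1) (by norm_num)]
      refine antitoneOn_of_deriv_nonpos (f := fun y => g.eval y) (convex_Icc (-1 : ℝ) 0)
        g.continuous.continuousOn g.differentiable.differentiableOn ?_
        ⟨le_rfl, by norm_num⟩ ⟨ht.1, h⟩ ht.1
      intro x hx
      rw [interior_Icc] at hx
      rw [hge]
      have := hx.2
      nlinarith [mul_nonneg (neg_nonneg.mpr this.le) (sq_nonneg ((derivative p).eval x))]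
  have hN : (0 : ℝ) < (n : ℝ) * (n + 1) := by positivity
  have h5 : (n : ℝ) * (n + 1) * p.eval t ^ 2 ≤ (n : ℝ) * (n + 1) * 1 := by
    refine le_trans ?_ (hle.trans_eq (mul_one _).symm)
    simp only [hg, eval_add, eval_mul, eval_C, eval_pow, eval_sub, eval_one, eval_X]
    have : 0 ≤ (1 - t ^ 2) * (derivative p).eval t ^ 2 :=
      mul_nonneg (by nlinarith [ht.1, ht.2]) (sq_nonneg _)
    linarith
  have h6 := le_of_mul_le_mul_left h5 hN
  exact abs_le_one_iff_mul_self_le_one.mpr (by simpa [P, ← hp, sq] using h6)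

/-- The integral of the product of three Legendre polynomials. -/
def tripleInt (s l n : ℕ) : ℝ := polyInt (legendrePoly s * legendrePoly n * legendrePoly l)

theorem tripleInt_eq_zero {s l n : ℕ} (h : l + n < s) : tripleInt s l n = 0 := by
  unfold tripleInt
  rw [mul_assoc]
  refine polyInt_legendrePoly_mul_eq_zero _ _ (degree_le_natDegree.trans_lt ?_)
  have := natDegree_mul_le (p := legendrePoly n) (q := legendrePoly l)
  have h1 := natDegree_legendrePoly_le n
  have h2 := natDegree_legendrePoly_le l
  exact_mod_cast (by omega : (legendrePoly n * legendrePoly l).natDegree < s)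

theorem abs_polyInt_mul_le (a b c : ℕ) :
    |polyInt (legendrePoly a * legendrePoly b * legendrePoly c)| ≤
      1 / (2 * a + 1) + 1 / (2 * b + 1) := by
  rw [polyInt_apply]
  have h1 : |∫ t in (-1 : ℝ)..1, (legendrePoly a * legendrePoly b * legendrePoly c).eval t| ≤
      ∫ t in (-1 : ℝ)..1, (C (1 / 2) * (legendrePoly a * legendrePoly a) +
        C (1 / 2) * (legendrePoly b * legendrePoly b)).eval t := by
    rw [← Real.norm_eq_abs]
    refine intervalIntegral.norm_integral_le_of_norm_le (by norm_num) ?_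
      ((Polynomial.continuous _).intervalIntegrable _ _)
    refine Filter.Eventually.of_forall fun t ht => ?_
    have hc := abs_P_le_one c (t := t) ⟨ht.1.le, ht.2⟩
    unfold P at hc
    simp only [eval_mul, eval_add, eval_C, norm_mul, Real.norm_eq_abs]
    set x := (legendrePoly a).eval t
    set y := (legendrePoly b).eval t
    calc |x| * |y| * |(legendrePoly c).eval t| ≤ |x| * |y| * 1 := by gcongr
      _ ≤ 1 / 2 * (x * x) + 1 / 2 * (y * y) := by
        nlinarith [sq_nonneg (|x| - |y|), abs_mul_abs_self x, abs_mul_abs_self y]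
  refine h1.trans_eq ?_
  rw [← polyInt_apply, map_add, polyInt_C_mul, polyInt_C_mul, polyInt_legendrePoly_sq,
    polyInt_legendrePoly_sq]
  ring

/-- A nonzero integral forces `l + n ≥ s`, so the larger of `l` and `n` is at least `s/2`. The
arithmetic-geometric mean estimate is applied to `P_s` and that polynomial, the third factor being
bounded by 1. -/
theorem abs_tripleInt_le {s l n : ℕ} (hs : 0 < s) : |tripleInt s l n| ≤ 2 / s := by
  rcases lt_or_ge (l + n) s with h | h
  · rw [tripleInt_eq_zero h, abs_zero]
    positivity
  have hs' : (0 : ℝ) < s := by exact_mod_cast hs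
  have key : ∀ a : ℕ, s ≤ 2 * a → (1 : ℝ) / (2 * s + 1) + 1 / (2 * a + 1) ≤ 2 / s := by
    intro a ha
    have ha' : (s : ℝ) ≤ 2 * a := by exact_mod_cast ha
    calc (1 : ℝ) / (2 * s + 1) + 1 / (2 * a + 1) ≤ 1 / s + 1 / s := by gcongr <;> linarith
      _ = 2 / s := by ring
  rcases le_total n l with hnl | hnl
  · refine le_trans ?_ (key l (by omega))
    rw [tripleInt, mul_right_comm]
    exact abs_polyInt_mul_le s l n
  · refine le_trans ?_ (key n (by omega))
    exact abs_polyInt_mul_le s n l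

/-- The linearization of the product of two Legendre polynomials. -/
theorem P_mul_P_eq_sum (s n : ℕ) (t : ℝ) :
    P s t * P n t =
      ∑ l ∈ Finset.range (s + n + 1), (2 * (l : ℝ) + 1) / 2 * tripleInt s l n * P l t := by
  have h := eq_sum_legendrePoly (s + n + 1) (legendrePoly s * legendrePoly n) (by
    refine degree_le_natDegree.trans_lt ?_
    have := natDegree_mul_le (p := legendrePoly s) (q := legendrePoly n)
    have h1 := natDegree_legendrePoly_le n
    have h2 := natDegree_legendrePoly_le s
    exact_mod_cast (by omega : (legendrePoly s * legendrePoly n).natDegree < s + n + 1))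
  have h' := congrArg (fun p => p.eval t) h
  simp only [eval_mul, eval_finsetSum, eval_C] at h'
  exact h'

end Legendre

/-! ### Completeness and term-by-term integration of Legendre series -/

section Expansion

open Polynomial Topology

theorem continuous_P (n : ℕ) : Continuous (P n) := (legendrePoly n).continuous

theorem norm_P_le_one (n : ℕ) {t : ℝ} (ht : t ∈ Icc (-1 : ℝ) 1) : ‖(P n t : ℂ)‖ ≤ 1 := by
  rw [Complex.norm_real]
  exact abs_P_le_one n ht

theorem intervalIntegrable_of_bounded {f : ℝ → ℂ} {a b : ℝ} (hab : a ≤ b) (hf : Measurable f)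
    {M : ℝ} (hM : ∀ t ∈ Icc a b, ‖f t‖ ≤ M) : IntervalIntegrable f volume a b := by
  rw [intervalIntegrable_iff_integrableOn_Ioc_of_le hab]
  refine Measure.integrableOn_of_bounded (M := M) (by simp) hf.aestronglyMeasurable ?_
  rw [ae_restrict_iff' measurableSet_Ioc]
  exact Eventually.of_forall fun t ht => hM t ⟨ht.1.le, ht.2⟩

theorem intervalIntegral_mul_polynomial_eq_zero {f : ℝ → ℂ}
    (hf : IntervalIntegrable f volume (-1) 1)
    (h : ∀ n, ∫ t in (-1 : ℝ)..1, f t * (P n t : ℂ) = 0) (q : ℝ[X]) :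
    ∫ t in (-1 : ℝ)..1, f t * ((q.eval t : ℝ) : ℂ) = 0 := by
  have hq : q.degree < ((q.natDegree + 1 : ℕ) : WithBot ℕ) :=
    degree_le_natDegree.trans_lt (by exact_mod_cast Nat.lt_succ_self _)
  have he := eq_sum_legendrePoly _ q hq
  set c : ℕ → ℝ := fun l => (2 * (l : ℝ) + 1) / 2 * polyInt (q * legendrePoly l) with hc
  have h1 : ∀ t, f t * ((q.eval t : ℝ) : ℂ) =
      ∑ l ∈ Finset.range (q.natDegree + 1), (c l : ℂ) * (f t * (P l t : ℂ)) := by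
    intro t
    conv_lhs => rw [he]
    simp only [eval_finsetSum, eval_mul, eval_C, Complex.ofReal_sum, Finset.mul_sum, P]
    refine Finset.sum_congr rfl fun l _ => ?_
    push_cast [hc]
    ring
  simp_rw [h1]
  rw [intervalIntegral.integral_finsetSum]
  · simp [intervalIntegral.integral_const_mul, h]
  · intro l _
    exact (hf.mul_continuousOn
      (Complex.continuous_ofReal.comp (continuous_P l)).continuousOn).const_mul _

/-- Weierstrass approximation: replacing `g` by a polynomial within `ε` changes the integral by at
most `ε` times the `L^1` norm of `f`. -/
theorem intervalIntegral_smul_continuous_eq_zero {f : ℝ → ℂ}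
    (hf : IntervalIntegrable f volume (-1) 1)
    (h : ∀ n, ∫ t in (-1 : ℝ)..1, f t * (P n t : ℂ) = 0) {g : ℝ → ℝ} (hg : Continuous g) :
    ∫ t in (-1 : ℝ)..1, g t • f t = 0 := by
  set A := ∫ t in (-1 : ℝ)..1, ‖f t‖ with hA
  have hA0 : 0 ≤ A := intervalIntegral.integral_nonneg (by norm_num) fun _ _ => norm_nonneg _
  have key : ∀ ε > 0, ‖∫ t in (-1 : ℝ)..1, g t • f t‖ ≤ ε * A := by
    intro ε hε
    obtain ⟨q, hq⟩ := exists_polynomial_near_of_continuousOn (-1) 1 g hg.continuousOn ε hε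
    have h1 : ∫ t in (-1 : ℝ)..1, g t • f t =
        ∫ t in (-1 : ℝ)..1, (g t • f t - f t * ((q.eval t : ℝ) : ℂ)) := by
      rw [intervalIntegral.integral_sub, intervalIntegral_mul_polynomial_eq_zero hf h, sub_zero]
      · exact hf.continuousOn_smul hg.continuousOn
      · exact hf.mul_continuousOn (Complex.continuous_ofReal.comp q.continuous).continuousOn
    rw [h1, hA, ← intervalIntegral.integral_const_mul]
    refine intervalIntegral.norm_integral_le_of_norm_le (by norm_num) ?_ (hf.norm.const_mul _)
    refine Eventually.of_forall fun t ht => ?_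
    have h2 : g t • f t - f t * ((q.eval t : ℝ) : ℂ) = ((g t - q.eval t : ℝ) : ℂ) * f t := by
      rw [Complex.real_smul]
      push_cast
      ring
    rw [h2, norm_mul, Complex.norm_real, Real.norm_eq_abs, abs_sub_comm]
    gcongr
    exact (hq t ⟨ht.1.le, ht.2⟩).le
  rw [← norm_le_zero_iff]
  refine le_of_forall_pos_le_add fun δ hδ => (key (δ / (A + 1)) (by positivity)).trans ?_
  rw [zero_add, div_mul_eq_mul_div, div_le_iff₀ (by positivity)]
  nlinarith

/-- Completeness of the Legendre polynomials. -/
theorem ae_eq_zero_of_legendre_coeff_eq_zero {f : ℝ → ℂ}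
    (hf : IntervalIntegrable f volume (-1) 1)
    (h : ∀ n, ∫ t in (-1 : ℝ)..1, f t * (P n t : ℂ) = 0) :
    ∀ᵐ t ∂(volume.restrict (Ioc (-1 : ℝ) 1)), f t = 0 := by
  have hf' := (intervalIntegrable_iff_integrableOn_Ioc_of_le (by norm_num)).mp hf
  refine ae_eq_zero_of_integral_contDiff_smul_eq_zero hf'.integrable.locallyIntegrable
    fun g hg _ => ?_
  rw [← intervalIntegral.integral_of_le (by norm_num)]
  exact intervalIntegral_smul_continuous_eq_zero hf h hg.continuous

theorem integral_P_mul_P (s n : ℕ) :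
    ∫ t in (-1 : ℝ)..1, (P s t : ℂ) * (P n t : ℂ) =
      if s = n then 2 / (2 * (n : ℂ) + 1) else 0 := by
  have h : ∀ t, (P s t : ℂ) * (P n t : ℂ) =
      (((legendrePoly s * legendrePoly n).eval t : ℝ) : ℂ) := by
    intro t
    simp [P]
  simp_rw [h]
  rw [intervalIntegral.integral_ofReal, ← polyInt_apply]
  split_ifs with hsn
  · rw [hsn, polyInt_legendrePoly_sq]
    push_cast
    rfl
  · rw [polyInt_legendrePoly_mul_of_ne hsn]
    simp

/-- A Legendre series with summable coefficients may be integrated term by term. -/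
theorem hasSum_integral_legendre_series {c : ℕ → ℂ} (hc : Summable fun s => ‖c s‖) {h : ℝ → ℂ}
    (hh : Measurable h) {M : ℝ} (hM : ∀ t ∈ Icc (-1 : ℝ) 1, ‖h t‖ ≤ M) :
    HasSum (fun s => c s * ∫ t in (-1 : ℝ)..1, (P s t : ℂ) * h t)
      (∫ t in (-1 : ℝ)..1, (∑' s, c s * (P s t : ℂ)) * h t) := by
  simp_rw [← intervalIntegral.integral_const_mul]
  have hsub : ∀ t, t ∈ uIoc (-1 : ℝ) 1 → t ∈ Icc (-1 : ℝ) 1 := by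
    intro t ht
    rw [uIoc_of_le (by norm_num)] at ht
    exact ⟨ht.1.le, ht.2⟩
  have hb : ∀ s, ∀ t ∈ Icc (-1 : ℝ) 1, ‖c s * (P s t : ℂ)‖ ≤ ‖c s‖ := by
    intro s t ht
    rw [norm_mul]
    exact mul_le_of_le_one_right (norm_nonneg _) (norm_P_le_one s ht)
  refine intervalIntegral.hasSum_integral_of_dominated_convergence
    (fun s _ => ‖c s‖ * M) ?_ ?_ ?_ ?_ ?_
  · intro s
    exact (((Complex.continuous_ofReal.comp (continuous_P s)).measurable.mul hh).const_mul
      _).aestronglyMeasurable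
  · intro s
    refine Eventually.of_forall fun t ht => ?_
    rw [← mul_assoc, norm_mul]
    have := hb s t (hsub t ht)
    have := hM t (hsub t ht)
    gcongr
  · exact Eventually.of_forall fun t _ => hc.mul_right M
  · exact intervalIntegrable_const
  · refine Eventually.of_forall fun t ht => ?_
    have h1 : Summable fun s => c s * (P s t : ℂ) :=
      Summable.of_norm_bounded hc fun s => hb s t (hsub t ht)
    simpa only [mul_assoc] using h1.hasSum.mul_right (h t)

/-- Parseval-type formula for a bounded function whose Legendre coefficients are summable. -/
theorem hasSum_integral_mul_of_summable_coeff {f h : ℝ → ℂ} (hf : Measurable f)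
    {A : ℝ} (hA : ∀ t ∈ Icc (-1 : ℝ) 1, ‖f t‖ ≤ A)
    (hh : Measurable h) {M : ℝ} (hM : ∀ t ∈ Icc (-1 : ℝ) 1, ‖h t‖ ≤ M) {c : ℕ → ℂ}
    (hcf : ∀ s, c s = ((2 * (s : ℂ) + 1) / 2) * ∫ t in (-1 : ℝ)..1, f t * (P s t : ℂ))
    (hc : Summable fun s => ‖c s‖) :
    HasSum (fun s => c s * ∫ t in (-1 : ℝ)..1, (P s t : ℂ) * h t)
      (∫ t in (-1 : ℝ)..1, f t * h t) := by
  have hle : (-1 : ℝ) ≤ 1 := by norm_num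
  set g : ℝ → ℂ := fun t => ∑' s, c s * (P s t : ℂ) with hg
  have hgc : ContinuousOn g (Icc (-1) 1) := by
    refine continuousOn_tsum (u := fun s => ‖c s‖) (fun s => ?_) hc ?_
    · exact (continuous_const.mul (Complex.continuous_ofReal.comp (continuous_P s))).continuousOn
    · intro s t ht
      rw [norm_mul]
      exact mul_le_of_le_one_right (norm_nonneg _) (norm_P_le_one s ht)
  have hgi : IntervalIntegrable g volume (-1) 1 := by
    refine ContinuousOn.intervalIntegrable ?_
    rwa [uIcc_of_le hle]
  have hfi := intervalIntegrable_of_bounded hle hf hA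
  have hPc : ∀ n, Continuous fun t => (P n t : ℂ) := fun n =>
    Complex.continuous_ofReal.comp (continuous_P n)
  -- The uniformly convergent series and `f` have the same Legendre coefficients, so they agree
  -- almost everywhere, which suffices under the integral.
  have hgf : ∀ᵐ t ∂(volume.restrict (Ioc (-1 : ℝ) 1)), g t - f t = 0 := by
    refine ae_eq_zero_of_legendre_coeff_eq_zero (hgi.sub hfi) fun n => ?_
    simp_rw [sub_mul]
    rw [intervalIntegral.integral_sub (hgi.mul_continuousOn (hPc n).continuousOn)
      (hfi.mul_continuousOn (hPc n).continuousOn), sub_eq_zero]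
    have h1 := hasSum_integral_legendre_series hc (hPc n).measurable
      (fun t ht => norm_P_le_one n ht)
    simp_rw [integral_P_mul_P] at h1
    have h2 := h1.unique (hasSum_single n fun s hs => by simp [hs])
    rw [h2, if_pos rfl, hcf]
    have : (2 * (n : ℂ) + 1) ≠ 0 := by exact_mod_cast (by positivity : (2 * n + 1 : ℕ) ≠ 0)
    field_simp
  have h3 : ∫ t in (-1 : ℝ)..1, f t * h t = ∫ t in (-1 : ℝ)..1, g t * h t := by
    rw [intervalIntegral.integral_of_le hle, intervalIntegral.integral_of_le hle]
    refine integral_congr_ae ?_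
    filter_upwards [hgf] with t ht
    rw [sub_eq_zero.mp ht]
  rw [h3]
  exact hasSum_integral_legendre_series hc hh hM

theorem integral_P_mul_mul_P {f : ℝ → ℂ} (hf : IntervalIntegrable f volume (-1) 1) (s n : ℕ) :
    ∫ t in (-1 : ℝ)..1, (P s t : ℂ) * (f t * (P n t : ℂ)) =
      ∑ l ∈ Finset.range (s + n + 1), (tripleInt s l n : ℂ) *
        (((2 * (l : ℂ) + 1) / 2) * ∫ t in (-1 : ℝ)..1, f t * (P l t : ℂ)) := by
  have h1 : ∀ t, (P s t : ℂ) * (f t * (P n t : ℂ)) = ∑ l ∈ Finset.range (s + n + 1),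
      ((tripleInt s l n : ℂ) * ((2 * (l : ℂ) + 1) / 2)) * (f t * (P l t : ℂ)) := by
    intro t
    have h := congrArg (fun x : ℝ => (x : ℂ)) (P_mul_P_eq_sum s n t)
    push_cast at h
    rw [mul_left_comm, h, Finset.mul_sum]
    exact Finset.sum_congr rfl fun l _ => by ring
  simp_rw [h1]
  rw [intervalIntegral.integral_finsetSum]
  · simp [intervalIntegral.integral_const_mul, mul_assoc]
  · intro l _
    exact (hf.mul_continuousOn
      (Complex.continuous_ofReal.comp (continuous_P l)).continuousOn).const_mul _

/-- Only `s - n ≤ l ≤ s + n` contributes. The condition `n < s` keeps `l = 0` out of the window, so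
a bound on the coefficients of positive order suffices. -/
theorem norm_integral_P_mul_mul_P_le {f : ℝ → ℂ} (hf : IntervalIntegrable f volume (-1) 1)
    {b : ℕ → ℝ}
    (hb : ∀ l : ℕ, 1 ≤ l → ‖((2 * (l : ℂ) + 1) / 2) * ∫ t in (-1 : ℝ)..1, f t * (P l t : ℂ)‖ ≤ b l)
    {s n : ℕ} (hn : n < s) :
    ‖∫ t in (-1 : ℝ)..1, (P s t : ℂ) * (f t * (P n t : ℂ))‖ ≤
      2 / s * ∑ l ∈ Finset.Ico (s - n) (s + n + 1), b l := by
  rw [integral_P_mul_mul_P hf, Finset.mul_sum]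
  have h0 : ∑ l ∈ Finset.range (s + n + 1), (tripleInt s l n : ℂ) *
        (((2 * (l : ℂ) + 1) / 2) * ∫ t in (-1 : ℝ)..1, f t * (P l t : ℂ)) =
      ∑ l ∈ Finset.Ico (s - n) (s + n + 1), (tripleInt s l n : ℂ) *
        (((2 * (l : ℂ) + 1) / 2) * ∫ t in (-1 : ℝ)..1, f t * (P l t : ℂ)) := by
    symm
    refine Finset.sum_subset ?_ ?_
    · intro l hl
      simp only [Finset.mem_Ico, Finset.mem_range] at hl ⊢
      omega
    · intro l hl hl'
      simp only [Finset.mem_Ico, Finset.mem_range, not_and_or] at hl hl'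
      rw [tripleInt_eq_zero (by omega)]
      simp
  rw [h0]
  refine (norm_sum_le _ _).trans (Finset.sum_le_sum fun l hl => ?_)
  rw [Finset.mem_Ico] at hl
  rw [norm_mul, Complex.norm_real, Real.norm_eq_abs]
  exact mul_le_mul (abs_tripleInt_le (by omega)) (hb l (by omega)) (norm_nonneg _) (by positivity)

end Expansion

/-! ### Bounds for spherical Bessel and Hankel functions -/

section Bessel

theorem hasSum_pow_div_factorial (x : ℝ) :
    HasSum (fun p : ℕ => x ^ p / (p.factorial : ℝ)) (Real.exp x) := by
  rw [Real.exp_eq_exp_ℝ]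
  exact NormedSpace.expSeries_div_hasSum_exp x

/-- The denominators `d` are left general so that the series of `j_n` and `y_n` are handled
together: both are dominated by the series of `exp (x^2/2)`. -/
theorem norm_besselTerm_le (x : ℝ) {d : ℕ → ℝ} (hd : ∀ p, 1 ≤ |d p|) (p : ℕ) :
    ‖(-(x ^ 2 / 2)) ^ p / ((p.factorial : ℝ) * d p)‖ ≤ (x ^ 2 / 2) ^ p / (p.factorial : ℝ) := by
  have hf : (0 : ℝ) < p.factorial := by positivity
  rw [norm_div, norm_mul, norm_pow, norm_neg, Real.norm_of_nonneg (by positivity),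
    Real.norm_of_nonneg hf.le, Real.norm_eq_abs]
  gcongr
  exact le_mul_of_one_le_right hf.le (hd p)

theorem abs_besselSeries_le (x : ℝ) {d : ℕ → ℝ} (hd : ∀ p, 1 ≤ |d p|) :
    |∑' p : ℕ, (-(x ^ 2 / 2)) ^ p / ((p.factorial : ℝ) * d p)| ≤ Real.exp (x ^ 2 / 2) := by
  rw [← Real.norm_eq_abs]
  exact tsum_of_norm_bounded (hasSum_pow_div_factorial _) (norm_besselTerm_le x hd)

theorem measurable_besselSeries {d : ℕ → ℝ} (hd : ∀ p, 1 ≤ |d p|) :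
    Measurable fun x : ℝ => ∑' p : ℕ, (-(x ^ 2 / 2)) ^ p / ((p.factorial : ℝ) * d p) := by
  refine measurable_of_tendsto_metrizable (f := fun (N : ℕ) (x : ℝ) =>
    ∑ p ∈ Finset.range N, (-(x ^ 2 / 2)) ^ p / ((p.factorial : ℝ) * d p)) (fun N => ?_) ?_
  · fun_prop
  · rw [tendsto_pi_nhds]
    intro x
    exact (Summable.of_norm_bounded (hasSum_pow_div_factorial _).summable
      (norm_besselTerm_le x hd)).hasSum.tendsto_sum_nat

theorem one_le_abs_prod_sphJ (n p : ℕ) :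
    1 ≤ |∏ q ∈ Finset.range p, (2 * (n : ℝ) + 2 * (q : ℝ) + 3)| := by
  rw [Finset.abs_prod]
  refine Finset.one_le_prod fun q _ => ?_
  rw [abs_of_nonneg (by positivity)]
  have : (0 : ℝ) ≤ n := by positivity
  have : (0 : ℝ) ≤ q := by positivity
  linarith

/-- The factors may be negative, but they are odd integers and so have absolute value at least 1. -/
theorem one_le_abs_prod_sphY (n p : ℕ) :
    1 ≤ |∏ q ∈ Finset.range p, (2 * (q : ℝ) + 1 - 2 * (n : ℝ))| := by
  rw [Finset.abs_prod]
  refine Finset.one_le_prod fun q _ => ?_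
  have h : (1 : ℤ) ≤ |2 * (q : ℤ) + 1 - 2 * (n : ℤ)| := Int.one_le_abs (by omega)
  exact_mod_cast h

/-- The double factorial `(2n-1)!! = 1·3·5⋯(2n-1)`. -/
def oddFact (n : ℕ) : ℝ := ∏ q ∈ Finset.range n, (2 * (q : ℝ) + 1)

theorem oddFact_succ (n : ℕ) : oddFact (n + 1) = oddFact n * (2 * n + 1) :=
  Finset.prod_range_succ _ _

theorem oddFact_pos (n : ℕ) : 0 < oddFact n := Finset.prod_pos fun q _ => by positivity

theorem factorial_le_oddFact_succ (n : ℕ) : (n.factorial : ℝ) ≤ oddFact (n + 1) := by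
  induction n with
  | zero => simp [oddFact]
  | succ n ih =>
    rw [oddFact_succ, Nat.factorial_succ, mul_comm]
    push_cast
    exact mul_le_mul ih (by linarith [n.cast_nonneg (α := ℝ)]) (by positivity) (oddFact_pos _).le

theorem one_le_oddFact (n : ℕ) : 1 ≤ oddFact n :=
  Finset.one_le_prod fun q _ => by
    have : (0 : ℝ) ≤ q := by positivity
    linarith

theorem abs_sphJ_le (n : ℕ) {x : ℝ} (hx : 0 ≤ x) :
    |sphJ n x| ≤ x ^ n / oddFact (n + 1) * Real.exp (x ^ 2 / 2) := by
  unfold sphJ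
  rw [abs_mul]
  refine mul_le_mul (le_of_eq ?_) (abs_besselSeries_le x (one_le_abs_prod_sphJ n)) (abs_nonneg _) ?_
  · exact abs_of_nonneg (div_nonneg (by positivity) (oddFact_pos _).le)
  · exact div_nonneg (by positivity) (oddFact_pos _).le

theorem abs_sphY_le (n : ℕ) {x : ℝ} (hx : 0 < x) :
    |sphY n x| ≤ oddFact n / x ^ (n + 1) * Real.exp (x ^ 2 / 2) := by
  unfold sphY
  rw [abs_mul, abs_neg]
  refine mul_le_mul (le_of_eq ?_) (abs_besselSeries_le x (one_le_abs_prod_sphY n)) (abs_nonneg _) ?_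
  · exact abs_of_nonneg (div_nonneg (oddFact_pos _).le (by positivity))
  · exact div_nonneg (oddFact_pos _).le (by positivity)

theorem measurable_sphJ (n : ℕ) : Measurable (sphJ n) := by
  unfold sphJ
  have := measurable_besselSeries (one_le_abs_prod_sphJ n)
  fun_prop

theorem measurable_sphY (n : ℕ) : Measurable (sphY n) := by
  unfold sphY
  have := measurable_besselSeries (one_le_abs_prod_sphY n)
  fun_prop

theorem measurable_sphH (n : ℕ) : Measurable (sphH n) := by
  unfold sphH
  have := measurable_sphJ n
  have := measurable_sphY n
  fun_prop

/-- Uniform bound for the product of spherical Hankel and Bessel functions of the same order. -/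
theorem norm_sphH_mul_sphJ_le (n : ℕ) {M x y : ℝ} (hx : 0 ≤ x) (hy : 0 < y) (hxM : x ≤ M)
    (hyM : y ≤ M) :
    (2 * n + 1) * (‖sphH n y‖ * ‖(sphJ n x : ℂ)‖) ≤
      (Real.exp (M ^ 2 / 2) ^ 2 * (1 + M * Real.exp (M ^ 2))) * (x ^ n / y ^ (n + 1)) := by
  have hM : 0 < M := hy.trans_le hyM
  set E := Real.exp (M ^ 2 / 2) with hE
  set d := oddFact (n + 1) with hd
  have hd0 : 0 < d := oddFact_pos _
  have hd1 : 1 ≤ oddFact n := one_le_oddFact n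
  have hds : d = oddFact n * (2 * n + 1) := oddFact_succ n
  have hjx : ‖(sphJ n x : ℂ)‖ ≤ x ^ n / d * E := by
    rw [Complex.norm_real]
    refine (abs_sphJ_le n hx).trans ?_
    rw [hE]
    gcongr
  have hh : ‖sphH n y‖ ≤ y ^ n / d * E + oddFact n / y ^ (n + 1) * E := by
    unfold sphH
    refine (norm_add_le _ _).trans ?_
    rw [norm_mul, Complex.norm_I, one_mul, Complex.norm_real, Complex.norm_real]
    refine add_le_add ((abs_sphJ_le n hy.le).trans ?_) ((abs_sphY_le n hy).trans ?_)
    · rw [hE]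
      gcongr
    · have := oddFact_pos n
      rw [hE]
      gcongr
  -- This controls the `j_n` part of `h_n` relative to the dominant `y_n` part, uniformly in `n`.
  have hy1 : y ^ (2 * n + 1) / d ≤ M * Real.exp (M ^ 2) := by
    calc y ^ (2 * n + 1) / d ≤ M ^ (2 * n + 1) / n.factorial := by
          gcongr
          exact factorial_le_oddFact_succ n
      _ = M * ((M ^ 2) ^ n / n.factorial) := by rw [pow_succ, pow_mul]; ring
      _ ≤ M * Real.exp (M ^ 2) := by
          gcongr
          exact Real.pow_div_factorial_le_exp _ (by positivity) n
  calc (2 * n + 1) * (‖sphH n y‖ * ‖(sphJ n x : ℂ)‖)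
      ≤ (2 * n + 1) * ((y ^ n / d * E + oddFact n / y ^ (n + 1) * E) * (x ^ n / d * E)) := by
        gcongr
    _ = E ^ 2 * (1 + y ^ (2 * n + 1) / d / oddFact n) * (x ^ n / y ^ (n + 1)) := by
        have h1 : oddFact n ≠ 0 := (oddFact_pos n).ne'
        have h2 : (2 * (n : ℝ) + 1) ≠ 0 := by positivity
        rw [hds]
        field_simp
        ring
    _ ≤ E ^ 2 * (1 + M * Real.exp (M ^ 2)) * (x ^ n / y ^ (n + 1)) := by
        gcongr
        exact (div_le_self (by positivity) hd1).trans hy1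

end Bessel

/-! ### Radial kernel and the gain `1/(n+1)` -/

section Radial

theorem integral_one_sub_abs_div_pow_le {R a : ℝ} (hR : 0 < R) (ha : a ∈ Icc 0 R) (n : ℕ) :
    ∫ ρ in (0 : ℝ)..R, (1 - |a - ρ| / R) ^ n ≤ 2 * R / (n + 1) := by
  have hi : ∀ b c : ℝ, IntervalIntegrable (fun ρ => (1 - |a - ρ| / R) ^ n) volume b c :=
    fun b c => Continuous.intervalIntegrable (by fun_prop) _ _
  have hn : (n : ℝ) + 1 ≠ 0 := by positivity
  rw [← intervalIntegral.integral_add_adjacent_intervals (hi 0 a) (hi a R)]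
  have h1 : ∫ ρ in (0 : ℝ)..a, (1 - |a - ρ| / R) ^ n ≤ R / (n + 1) := by
    have e : ∫ ρ in (0 : ℝ)..a, (1 - |a - ρ| / R) ^ n =
        ∫ ρ in (0 : ℝ)..a, (1 - (a - ρ) / R) ^ n := by
      refine intervalIntegral.integral_congr fun ρ hρ => ?_
      rw [uIcc_of_le ha.1] at hρ
      simp only [abs_of_nonneg (sub_nonneg.mpr hρ.2)]
    rw [e, intervalIntegral.integral_eq_sub_of_hasDerivAt
      (f := fun ρ => R / (n + 1) * (1 - (a - ρ) / R) ^ (n + 1))]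
    · have h0 : 0 ≤ 1 - (a - 0) / R := by
        rw [sub_nonneg, div_le_one hR]
        linarith [ha.2]
      have : 0 ≤ R / ((n : ℝ) + 1) * (1 - (a - 0) / R) ^ (n + 1) := by positivity
      simp only [sub_self, zero_div, sub_zero, one_pow, mul_one] at this ⊢
      linarith
    · intro ρ _
      have hd : HasDerivAt (fun ρ : ℝ => 1 - (a - ρ) / R) (1 / R) ρ := by
        have := (((hasDerivAt_id ρ).const_sub a).div_const R).const_sub 1
        simpa [neg_div] using this
      convert! (hd.pow (n + 1)).const_mul (R / ((n : ℝ) + 1)) using 1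
      push_cast
      field_simp
    · exact Continuous.intervalIntegrable (by fun_prop) _ _
  have h2 : ∫ ρ in a..R, (1 - |a - ρ| / R) ^ n ≤ R / (n + 1) := by
    have e : ∫ ρ in a..R, (1 - |a - ρ| / R) ^ n =
        ∫ ρ in a..R, (1 - (ρ - a) / R) ^ n := by
      refine intervalIntegral.integral_congr fun ρ hρ => ?_
      rw [uIcc_of_le ha.2] at hρ
      simp only [abs_sub_comm a ρ, abs_of_nonneg (sub_nonneg.mpr hρ.1)]
    rw [e, intervalIntegral.integral_eq_sub_of_hasDerivAt
      (f := fun ρ => -(R / (n + 1)) * (1 - (ρ - a) / R) ^ (n + 1))]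
    · have h0 : 0 ≤ 1 - (R - a) / R := by
        rw [sub_nonneg, div_le_one hR]
        linarith [ha.1]
      have : 0 ≤ R / ((n : ℝ) + 1) * (1 - (R - a) / R) ^ (n + 1) := by positivity
      simp only [sub_self, zero_div, sub_zero, one_pow, mul_one] at this ⊢
      linarith
    · intro ρ _
      have hd : HasDerivAt (fun ρ : ℝ => 1 - (ρ - a) / R) (-(1 / R)) ρ := by
        have := (((hasDerivAt_id ρ).sub_const a).div_const R).const_sub 1
        simpa using this
      convert! (hd.pow (n + 1)).const_mul (-(R / ((n : ℝ) + 1))) using 1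
      push_cast
      field_simp
    · exact Continuous.intervalIntegrable (by fun_prop) _ _
  calc _ ≤ R / ((n : ℝ) + 1) + R / (n + 1) := add_le_add h1 h2
    _ = 2 * R / (n + 1) := by ring

theorem min_div_max_le {R a ρ : ℝ} (ha : a ∈ Icc 0 R) (hρ : ρ ∈ Ioc 0 R) :
    min a ρ / max a ρ ≤ 1 - |a - ρ| / R := by
  have hmax : 0 < max a ρ := lt_max_of_lt_right hρ.1
  have hmaxR : max a ρ ≤ R := max_le ha.2 hρ.2
  have h1 : min a ρ / max a ρ = 1 - |a - ρ| / max a ρ := by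
    have : min a ρ = max a ρ - |a - ρ| := by
      rcases le_total a ρ with h | h
      · rw [min_eq_left h, max_eq_right h, abs_of_nonpos (sub_nonpos.mpr h)]; ring
      · rw [min_eq_right h, max_eq_left h, abs_of_nonneg (sub_nonneg.mpr h)]; ring
    rw [this, sub_div, div_self hmax.ne']
  rw [h1]
  gcongr

/-- The constant in the bound for the radial kernel. -/
def kernelConst (M : ℝ) : ℝ := Real.exp (M ^ 2 / 2) ^ 2 * (1 + M * Real.exp (M ^ 2))

theorem kernelConst_nonneg {M : ℝ} (hM : 0 ≤ M) : 0 ≤ kernelConst M := by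
  unfold kernelConst
  positivity

/-- After `x^n` is paired with `y^n`, one power of `1 / max a ρ` remains; the weight `ρ^2` absorbs
it, since `ρ^2 / max a ρ ≤ R`. The ratio is then replaced by an explicitly integrable function of
`|a - ρ|`. -/
theorem norm_kernel_le {κ R a ρ : ℝ} (hκ : 0 < κ) (ha : a ∈ Icc 0 R)
    (hρ : ρ ∈ Ioc 0 R) (n : ℕ) :
    (2 * n + 1) * ‖sphH n (κ * max a ρ) * (sphJ n (κ * min a ρ) : ℂ) * (ρ : ℂ) ^ 2‖ ≤
      kernelConst (κ * R) / κ * R * (1 - |a - ρ| / R) ^ n := by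
  have hmax : 0 < max a ρ := lt_max_of_lt_right hρ.1
  have hmaxR : max a ρ ≤ R := max_le ha.2 hρ.2
  have hmin : 0 ≤ min a ρ := le_min ha.1 hρ.1.le
  have hR : 0 < R := hρ.1.trans_le hρ.2
  have hC := kernelConst_nonneg (mul_pos hκ hR).le
  have h := norm_sphH_mul_sphJ_le n (M := κ * R) (x := κ * min a ρ) (y := κ * max a ρ)
    (by positivity) (by positivity)
    (mul_le_mul_of_nonneg_left (min_le_max.trans hmaxR) hκ.le)
    (mul_le_mul_of_nonneg_left hmaxR hκ.le)
  rw [norm_mul, norm_mul, norm_pow, Complex.norm_real ρ, Real.norm_of_nonneg hρ.1.le, ← mul_assoc]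
  have h2 : (κ * min a ρ) ^ n / (κ * max a ρ) ^ (n + 1) * ρ ^ 2 =
      1 / κ * (ρ ^ 2 / max a ρ) * (min a ρ / max a ρ) ^ n := by
    rw [div_pow, mul_pow, mul_pow, pow_succ, pow_succ]
    field_simp
  have h3 : ρ ^ 2 / max a ρ ≤ R := by
    rw [div_le_iff₀ hmax, sq]
    exact mul_le_mul hρ.2 (le_max_right _ _) hρ.1.le hR.le
  calc _ ≤ kernelConst (κ * R) * ((κ * min a ρ) ^ n / (κ * max a ρ) ^ (n + 1)) * ρ ^ 2 :=
        mul_le_mul_of_nonneg_right h (by positivity)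
    _ = kernelConst (κ * R) * (1 / κ * (ρ ^ 2 / max a ρ) * (min a ρ / max a ρ) ^ n) := by
        rw [mul_assoc, h2]
    _ ≤ kernelConst (κ * R) * (1 / κ * R * (1 - |a - ρ| / R) ^ n) := by
        gcongr
        exact min_div_max_le ha hρ
    _ = _ := by ring

/-- The prefactor `2n+1` is consumed by the kernel bound, and the decay `1/(n+1)` comes from
integrating `(1 - |a - ρ|/R)^n`. -/
theorem norm_opKn_le {κ R : ℝ} (hκ : 0 < κ) (hR : 0 < R) {m w : ℝ → ℝ → ℂ} {n : ℕ} {a D : ℝ}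
    (ha : a ∈ Icc 0 R) (hD : ∀ ρ ∈ Icc 0 R, ‖angInt m w n ρ‖ ≤ D) :
    ‖opKn κ R m n w a‖ ≤ 2 * κ ^ 2 * R ^ 2 * kernelConst (κ * R) * (D / (n + 1)) := by
  have hD0 : 0 ≤ D := (norm_nonneg _).trans (hD 0 ⟨le_rfl, hR.le⟩)
  have hC := kernelConst_nonneg (mul_pos hκ hR).le
  unfold opKn
  have h2n : ‖(2 * (n : ℂ) + 1)‖ = 2 * n + 1 := by
    rw [show (2 * (n : ℂ) + 1) = ((2 * n + 1 : ℝ) : ℂ) by push_cast; rfl, Complex.norm_real,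
      Real.norm_of_nonneg (by positivity)]
  rw [norm_mul, norm_mul, norm_neg, h2n, norm_pow, Complex.norm_real, Real.norm_of_nonneg hκ.le]
  have h1 : ‖∫ ρ in (0 : ℝ)..R, sphH n (κ * max a ρ) * (sphJ n (κ * min a ρ) : ℂ) *
      angInt m w n ρ * (ρ : ℂ) ^ 2‖ ≤
      ∫ ρ in (0 : ℝ)..R,
        kernelConst (κ * R) / κ * R * D / (2 * n + 1) * (1 - |a - ρ| / R) ^ n := by
    refine intervalIntegral.norm_integral_le_of_norm_le hR.le ?_
      (Continuous.intervalIntegrable (by fun_prop) _ _)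
    refine Eventually.of_forall fun ρ hρ => ?_
    have hk := norm_kernel_le hκ ha hρ n
    rw [mul_right_comm, norm_mul]
    calc _ ≤ kernelConst (κ * R) / κ * R * (1 - |a - ρ| / R) ^ n / (2 * n + 1) * D := by
          refine mul_le_mul ?_ (hD ρ ⟨hρ.1.le, hρ.2⟩) (norm_nonneg _) ?_
          · rw [le_div_iff₀' (by positivity)]
            exact hk
          · exact div_nonneg ((mul_nonneg (by positivity) (norm_nonneg _)).trans hk) (by positivity)
      _ = _ := by ring
  rw [intervalIntegral.integral_const_mul] at h1
  calc _ ≤ (2 * n + 1) * κ ^ 3 *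
        (kernelConst (κ * R) / κ * R * D / (2 * n + 1) * (2 * R / (n + 1))) := by
        gcongr
        refine h1.trans ?_
        gcongr
        exact integral_one_sub_abs_div_pow_le hR ha n
    _ = _ := by field_simp

end Radial

/-! ### Bounded measurable functions and linearity of the operators -/

section BddMeas

variable {R : ℝ}

theorem norm_le_of_supNorm_lt_top {f : ℝ → ℝ → ℂ} (hf : supNorm R f < ⊤) {ρ t : ℝ}
    (hρ : ρ ∈ Icc 0 R) (ht : t ∈ Icc (-1 : ℝ) 1) : ‖f ρ t‖ ≤ (supNorm R f).toReal := by
  rw [← toReal_enorm]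
  refine ENNReal.toReal_mono hf.ne ?_
  exact (le_iSup₂ (f := fun t (_ : t ∈ Icc (-1 : ℝ) 1) => ‖f ρ t‖ₑ) t ht).trans
    (le_iSup₂ (f := fun ρ (_ : ρ ∈ Icc (0 : ℝ) R) => ⨆ t ∈ Icc (-1 : ℝ) 1, ‖f ρ t‖ₑ) ρ hρ)

theorem supNorm_le_ofReal {f : ℝ → ℝ → ℂ} {c : ℝ}
    (h : ∀ ρ ∈ Icc 0 R, ∀ t ∈ Icc (-1 : ℝ) 1, ‖f ρ t‖ ≤ c) : supNorm R f ≤ ENNReal.ofReal c := by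
  refine iSup₂_le fun ρ hρ => iSup₂_le fun t ht => ?_
  rw [← ofReal_norm]
  exact ENNReal.ofReal_le_ofReal (h ρ hρ t ht)

theorem bddMeas_of_norm_le {f : ℝ → ℝ → ℂ} (hf : Measurable (Function.uncurry f)) {c : ℝ}
    (h : ∀ ρ ∈ Icc 0 R, ∀ t ∈ Icc (-1 : ℝ) 1, ‖f ρ t‖ ≤ c) : BddMeas R f :=
  ⟨hf, (supNorm_le_ofReal h).trans_lt ENNReal.ofReal_lt_top⟩

theorem BddMeas.exists_norm_le {f : ℝ → ℝ → ℂ} (hf : BddMeas R f) :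
    ∃ M : ℝ, 0 ≤ M ∧ ∀ ρ ∈ Icc 0 R, ∀ t ∈ Icc (-1 : ℝ) 1, ‖f ρ t‖ ≤ M :=
  ⟨_, ENNReal.toReal_nonneg, fun _ hρ _ ht => norm_le_of_supNorm_lt_top hf.2 hρ ht⟩

theorem BddMeas.measurable_apply {f : ℝ → ℝ → ℂ} (hf : BddMeas R f) (ρ : ℝ) :
    Measurable (f ρ) :=
  hf.1.comp measurable_prodMk_left

theorem BddMeas.sub {f g : ℝ → ℝ → ℂ} (hf : BddMeas R f) (hg : BddMeas R g) :
    BddMeas R fun ρ t => f ρ t - g ρ t := by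
  obtain ⟨A, -, hA⟩ := hf.exists_norm_le
  obtain ⟨B, -, hB⟩ := hg.exists_norm_le
  exact bddMeas_of_norm_le (hf.1.sub hg.1) (c := A + B) fun ρ hρ t ht =>
    (norm_sub_le _ _).trans (add_le_add (hA ρ hρ t ht) (hB ρ hρ t ht))

theorem BddMeas.mul {f g : ℝ → ℝ → ℂ} (hf : BddMeas R f) (hg : BddMeas R g) :
    BddMeas R fun ρ t => f ρ t * g ρ t := by
  obtain ⟨A, hA0, hA⟩ := hf.exists_norm_le
  obtain ⟨B, -, hB⟩ := hg.exists_norm_le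
  refine bddMeas_of_norm_le (hf.1.mul hg.1) (c := A * B) fun ρ hρ t ht => ?_
  rw [norm_mul]
  exact mul_le_mul (hA ρ hρ t ht) (hB ρ hρ t ht) (norm_nonneg _) hA0

theorem BddMeas.sum {ι : Type*} (s : Finset ι) {f : ι → ℝ → ℝ → ℂ}
    (hf : ∀ i ∈ s, BddMeas R (f i)) : BddMeas R fun ρ t => ∑ i ∈ s, f i ρ t := by
  classical
  induction s using Finset.induction_on with
  | empty =>
    simp only [Finset.sum_empty]
    exact bddMeas_of_norm_le measurable_const (c := 0) (by simp)
  | insert i s hi ih =>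
    obtain ⟨A, -, hA⟩ := (hf i (Finset.mem_insert_self i s)).exists_norm_le
    have hs := ih fun j hj => hf j (Finset.mem_insert_of_mem hj)
    obtain ⟨B, -, hB⟩ := hs.exists_norm_le
    simp only [Finset.sum_insert hi]
    exact bddMeas_of_norm_le ((hf i (Finset.mem_insert_self i s)).1.add hs.1) (c := A + B)
      fun ρ hρ t ht => (norm_add_le _ _).trans (add_le_add (hA ρ hρ t ht) (hB ρ hρ t ht))

theorem bddMeas_P (n : ℕ) : BddMeas R fun _ t => (P n t : ℂ) :=
  bddMeas_of_norm_le (c := 1)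
    (Complex.continuous_ofReal.comp ((continuous_P n).comp continuous_snd)).measurable
    fun _ _ _ ht => norm_P_le_one n ht

theorem BddMeas.intervalIntegrable {f : ℝ → ℝ → ℂ} (hf : BddMeas R f) {ρ : ℝ}
    (hρ : ρ ∈ Icc 0 R) : IntervalIntegrable (f ρ) volume (-1) 1 := by
  obtain ⟨A, -, hA⟩ := hf.exists_norm_le
  exact intervalIntegrable_of_bounded (by norm_num) (hf.measurable_apply ρ) (hA ρ hρ)

theorem measurable_integral_snd {f : ℝ → ℝ → ℂ} (hf : Measurable (Function.uncurry f)) :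
    Measurable fun ρ => ∫ t in (-1 : ℝ)..1, f ρ t := by
  simp_rw [intervalIntegral.integral_of_le (show (-1 : ℝ) ≤ 1 by norm_num)]
  exact (hf.stronglyMeasurable.integral_prod_right
    (ν := volume.restrict (Ioc (-1 : ℝ) 1))).measurable

theorem BddMeas.exists_norm_integral_le {f : ℝ → ℝ → ℂ} (hf : BddMeas R f) :
    ∃ M : ℝ, ∀ ρ ∈ Icc 0 R, ‖∫ t in (-1 : ℝ)..1, f ρ t‖ ≤ M := by
  obtain ⟨A, -, hA⟩ := hf.exists_norm_le
  refine ⟨A * |1 - (-1)|, fun ρ hρ => ?_⟩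
  refine intervalIntegral.norm_integral_le_of_norm_le_const fun t ht => ?_
  rw [uIoc_of_le (by norm_num)] at ht
  exact hA ρ hρ t ⟨ht.1.le, ht.2⟩

theorem BddMeas.coeff {f : ℝ → ℝ → ℂ} (hf : BddMeas R f) (n : ℕ) :
    BddMeas R fun ρ _ => coeff f n ρ := by
  have h := hf.mul (bddMeas_P n)
  obtain ⟨A, hA⟩ := h.exists_norm_integral_le
  refine bddMeas_of_norm_le (c := ‖(2 * (n : ℂ) + 1) / 2‖ * A)
    (((measurable_integral_snd h.1).comp measurable_fst).const_mul _) fun ρ hρ t _ => ?_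
  unfold AxiLS.coeff
  rw [norm_mul]
  exact mul_le_mul_of_nonneg_left (hA ρ hρ) (norm_nonneg _)

theorem BddMeas.trunc {f : ℝ → ℝ → ℂ} (hf : BddMeas R f) (F : ℕ) : BddMeas R (trunc F f) :=
  BddMeas.sum _ fun n _ => (hf.coeff n).mul (bddMeas_P n)

theorem angInt_sub {m w w' : ℝ → ℝ → ℂ} (hm : BddMeas R m) (hw : BddMeas R w)
    (hw' : BddMeas R w') (n : ℕ) {ρ : ℝ} (hρ : ρ ∈ Icc 0 R) :
    angInt m (fun ρ t => w ρ t - w' ρ t) n ρ = angInt m w n ρ - angInt m w' n ρ := by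
  unfold angInt
  rw [← intervalIntegral.integral_sub (((hw.mul hm).mul (bddMeas_P n)).intervalIntegrable hρ)
    (((hw'.mul hm).mul (bddMeas_P n)).intervalIntegrable hρ)]
  simp only [sub_mul]

/-- Needed to split the integral in `opKn_sub`; the kernel bound supplies a continuous majorant
despite the singularity of `h_n` at the origin. -/
theorem intervalIntegrable_opKn {κ : ℝ} (hκ : 0 < κ) (hR : 0 < R) {m w : ℝ → ℝ → ℂ}
    (hm : BddMeas R m) (hw : BddMeas R w) (n : ℕ) {a : ℝ} (ha : a ∈ Icc 0 R) :
    IntervalIntegrable (fun ρ => sphH n (κ * max a ρ) * (sphJ n (κ * min a ρ) : ℂ) *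
      angInt m w n ρ * (ρ : ℂ) ^ 2) volume 0 R := by
  have hwm := (hw.mul hm).mul (bddMeas_P n)
  obtain ⟨A, hA⟩ := hwm.exists_norm_integral_le
  have hI : Measurable (angInt m w n) := measurable_integral_snd hwm.1
  have hH := measurable_sphH n
  have hJ := measurable_sphJ n
  have hg : IntervalIntegrable (fun ρ => kernelConst (κ * R) / κ * R * A *
      (1 - |a - ρ| / R) ^ n) volume 0 R := Continuous.intervalIntegrable (by fun_prop) _ _
  refine hg.mono_fun (Measurable.aestronglyMeasurable ?_) ?_
  · have h1 : Measurable fun ρ => sphH n (κ * max a ρ) := hH.comp (by fun_prop)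
    have h2 : Measurable fun ρ => (sphJ n (κ * min a ρ) : ℂ) :=
      Complex.measurable_ofReal.comp (hJ.comp (by fun_prop))
    exact ((h1.mul h2).mul hI).mul (by fun_prop)
  · rw [EventuallyLE, ae_restrict_iff' measurableSet_uIoc]
    refine Eventually.of_forall fun ρ hρ => ?_
    rw [uIoc_of_le hR.le] at hρ
    have hk := norm_kernel_le hκ ha hρ n
    have hA' : ‖angInt m w n ρ‖ ≤ A := hA ρ ⟨hρ.1.le, hρ.2⟩
    rw [mul_right_comm, norm_mul]
    refine le_trans ?_ (le_abs_self _)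
    rw [mul_right_comm (kernelConst (κ * R) / κ * R) A]
    refine mul_le_mul (le_trans ?_ hk) hA' (norm_nonneg _)
      ((mul_nonneg (by positivity) (norm_nonneg _)).trans hk)
    refine le_mul_of_one_le_left (norm_nonneg _) ?_
    have : (0 : ℝ) ≤ n := by positivity
    linarith

theorem opKn_sub {κ : ℝ} (hκ : 0 < κ) (hR : 0 < R) {m w w' : ℝ → ℝ → ℂ} (hm : BddMeas R m)
    (hw : BddMeas R w) (hw' : BddMeas R w') (n : ℕ) {a : ℝ} (ha : a ∈ Icc 0 R) :
    opKn κ R m n (fun ρ t => w ρ t - w' ρ t) a = opKn κ R m n w a - opKn κ R m n w' a := by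
  unfold opKn
  rw [← mul_sub, ← intervalIntegral.integral_sub (intervalIntegrable_opKn hκ hR hm hw n ha)
    (intervalIntegrable_opKn hκ hR hm hw' n ha)]
  congr 1
  refine intervalIntegral.integral_congr fun ρ hρ => ?_
  rw [uIcc_of_le hR.le] at hρ
  simp only [angInt_sub hm hw hw' n hρ]
  ring

end BddMeas

/-! ### Power sums and the double sum over the Legendre tail -/

section Sums

/-- Comparison with the integral gives a factor `1/q`, dropped because `q ≥ 1`. -/
theorem sum_Ico_rpow_le {q : ℝ} (hq : 1 ≤ q) {F : ℕ} (hF : 0 < F) (N : ℕ) :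
    ∑ s ∈ Finset.Ico (F + 1) N, (s : ℝ) ^ (-(q + 1)) ≤ (F : ℝ) ^ (-q) := by
  have hF' : (0 : ℝ) < F := by exact_mod_cast hF
  rcases le_or_gt N (F + 1) with h | h
  · rw [Finset.Ico_eq_empty_of_le h, Finset.sum_empty]
    positivity
  obtain ⟨M, rfl⟩ : ∃ M, N = M + 1 := ⟨N - 1, by omega⟩
  have hFM : F ≤ M := by omega
  rw [← Finset.sum_Ico_add' (fun s : ℕ => (s : ℝ) ^ (-(q + 1))) F M 1]
  have hanti : AntitoneOn (fun x : ℝ => x ^ (-(q + 1))) (Icc (F : ℝ) M) := by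
    intro x hx y _ hxy
    exact Real.rpow_le_rpow_of_nonpos (hF'.trans_le hx.1) hxy (by linarith)
  refine (hanti.sum_le_integral_Ico hFM).trans ?_
  have hM' : (0 : ℝ) < M := by exact_mod_cast hF.trans_le hFM
  rw [integral_rpow (Or.inr ⟨by linarith, ?_⟩)]
  · rw [show -(q + 1) + 1 = -q by ring, div_neg, ← neg_div, neg_sub,
      div_le_iff₀ (by linarith)]
    have h1 : 0 < (M : ℝ) ^ (-q) := by positivity
    have h2 : 0 < (F : ℝ) ^ (-q) := by positivity
    nlinarith
  · rw [uIcc_of_le (by exact_mod_cast hFM)]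
    exact fun h0 => hF'.not_ge h0.1

/-- Induction on `F`; the increment is Bernoulli's inequality for the exponent `e + 1` in `[0,1]`.
-/
theorem sum_Icc_rpow_le_of_neg {e : ℝ} (he : -1 < e) (he0 : e ≤ 0) (F : ℕ) :
    ∑ l ∈ Finset.Icc 1 F, (l : ℝ) ^ e ≤ (F : ℝ) ^ (e + 1) / (e + 1) := by
  have he1 : 0 < e + 1 := by linarith
  induction F with
  | zero => simp [Real.zero_rpow he1.ne']
  | succ F ih =>
    rw [Finset.sum_Icc_succ_top (by omega)]
    refine (add_le_add_left ih _).trans ?_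
    rw [← le_sub_iff_add_le', ← sub_div, le_div_iff₀ he1]
    have hx : (0 : ℝ) < ((F + 1 : ℕ) : ℝ) := by positivity
    set x := ((F + 1 : ℕ) : ℝ) with hxd
    have hF : (F : ℝ) = x * (1 + -(1 / x)) := by
      rw [hxd]
      push_cast
      field_simp
      ring
    have hx1 : 1 ≤ x := by
      rw [hxd]
      push_cast
      linarith [F.cast_nonneg (α := ℝ)]
    have hx2 : 1 / x ≤ 1 := by rwa [div_le_one hx]
    have hb := rpow_one_add_le_one_add_mul_self (s := -(1 / x)) (by linarith) he1.le
      (by linarith)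
    have h1 : (F : ℝ) ^ (e + 1) ≤ x ^ (e + 1) * (1 + (e + 1) * -(1 / x)) := by
      rw [hF, Real.mul_rpow hx.le (by linarith)]
      gcongr
    have h2 : x ^ (e + 1) = x ^ e * x := by rw [Real.rpow_add hx, Real.rpow_one]
    have h3 : x ^ (e + 1) * (1 + (e + 1) * -(1 / x)) = x ^ (e + 1) - x ^ e * (e + 1) := by
      rw [h2]
      field_simp
      ring
    linarith

theorem exists_sum_Icc_rpow_le {e : ℝ} (he : -1 < e) :
    ∃ C : ℝ, 0 ≤ C ∧ ∀ F : ℕ, 0 < F →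
      ∑ l ∈ Finset.Icc 1 F, (l : ℝ) ^ e ≤ C * (F : ℝ) ^ (e + 1) := by
  rcases le_total e 0 with h | h
  · refine ⟨1 / (e + 1), by have : 0 < e + 1 := by linarith
                            positivity, fun F _ => ?_⟩
    exact (sum_Icc_rpow_le_of_neg he h F).trans_eq (by ring)
  · refine ⟨1, zero_le_one, fun F hF => ?_⟩
    have hF' : (0 : ℝ) < F := by exact_mod_cast hF
    calc ∑ l ∈ Finset.Icc 1 F, (l : ℝ) ^ e ≤ ∑ l ∈ Finset.Icc 1 F, (F : ℝ) ^ e := by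
          refine Finset.sum_le_sum fun l hl => ?_
          have := (Finset.mem_Icc.mp hl).2
          gcongr
      _ = 1 * (F : ℝ) ^ (e + 1) := by
          rw [Finset.sum_const, Nat.card_Icc, nsmul_eq_mul, Real.rpow_add hF', Real.rpow_one]
          simp
          ring

/-- The majorant of the angular integral of the Legendre tail at order `n`. -/
def tailMajorant (p : ℝ) (F n : ℕ) : ℝ :=
  (2 * n + 1) * 2 ^ p * (F : ℝ) ^ (-(2 * p + 2)) +
    (F : ℝ) ^ (-(p + 3)) *
      ∑ l ∈ Finset.Icc 1 F, if F < n + l ∧ 2 * l ≤ F then (l : ℝ) ^ (1 - p) else 0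

/-- The window has `2n+1` elements. Those with `l > F/2` are each at most `(F/2)^(-p)`, and the
smaller ones are kept for the exchange of sums. -/
theorem sum_Ico_rpow_window_le {p : ℝ} (hp : 0 < p) {F s n : ℕ} (hF : 0 < F) (hs : F < s)
    (hn : n ≤ F) :
    ∑ l ∈ Finset.Ico (s - n) (s + n + 1), (l : ℝ) ^ (-p) ≤
      (2 * n + 1) * (2 ^ p * (F : ℝ) ^ (-p)) +
        ∑ l ∈ Finset.Icc 1 F, if s ≤ n + l ∧ 2 * l ≤ F then (l : ℝ) ^ (-p) else 0 := by
  have hF' : (0 : ℝ) < F := by exact_mod_cast hF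
  have h1 : ∀ l ∈ Finset.Ico (s - n) (s + n + 1), (l : ℝ) ^ (-p) ≤
      2 ^ p * (F : ℝ) ^ (-p) + if 2 * l ≤ F then (l : ℝ) ^ (-p) else 0 := by
    intro l hl
    split_ifs with h
    · have : 0 < (2 : ℝ) ^ p * (F : ℝ) ^ (-p) := by positivity
      linarith
    · rw [add_zero]
      have hl' : (F : ℝ) / 2 ≤ l := by
        rw [div_le_iff₀ two_pos]
        exact_mod_cast (by omega : F ≤ l * 2)
      calc (l : ℝ) ^ (-p) ≤ ((F : ℝ) / 2) ^ (-p) :=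
            Real.rpow_le_rpow_of_nonpos (by positivity) hl' (by linarith)
        _ = 2 ^ p * (F : ℝ) ^ (-p) := by
            rw [Real.div_rpow hF'.le two_pos.le, Real.rpow_neg two_pos.le, div_inv_eq_mul,
              mul_comm]
  refine (Finset.sum_le_sum h1).trans ?_
  rw [Finset.sum_add_distrib, Finset.sum_const, Nat.card_Ico, nsmul_eq_mul]
  refine add_le_add (le_of_eq ?_) ?_
  · rw [show s + n + 1 - (s - n) = 2 * n + 1 by omega]
    push_cast
    rfl
  · rw [← Finset.sum_filter, ← Finset.sum_filter]
    refine Finset.sum_le_sum_of_subset_of_nonneg ?_ fun l _ _ => by positivity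
    intro l hl
    simp only [Finset.mem_filter, Finset.mem_Ico, Finset.mem_Icc] at hl ⊢
    omega

theorem sum_tail_le_tailMajorant {p : ℝ} (hp : 0 < p) {F n : ℕ} (hF : 0 < F) (hn : n ≤ F)
    (N : ℕ) :
    ∑ s ∈ Finset.Ico (F + 1) N, (s : ℝ) ^ (-(p + 3)) *
      ∑ l ∈ Finset.Ico (s - n) (s + n + 1), (l : ℝ) ^ (-p) ≤ tailMajorant p F n := by
  have hF' : (0 : ℝ) < F := by exact_mod_cast hF
  have h1 : ∀ s ∈ Finset.Ico (F + 1) N, (s : ℝ) ^ (-(p + 3)) *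
      ∑ l ∈ Finset.Ico (s - n) (s + n + 1), (l : ℝ) ^ (-p) ≤
      (s : ℝ) ^ (-(p + 3)) * ((2 * n + 1) * (2 ^ p * (F : ℝ) ^ (-p))) +
      (F : ℝ) ^ (-(p + 3)) *
        ∑ l ∈ Finset.Icc 1 F, if s ≤ n + l ∧ 2 * l ≤ F then (l : ℝ) ^ (-p) else 0 := by
    intro s hs
    rw [Finset.mem_Ico] at hs
    refine (mul_le_mul_of_nonneg_left (sum_Ico_rpow_window_le hp hF (by omega) hn)
      (by positivity)).trans ?_
    rw [mul_add]
    refine add_le_add le_rfl (mul_le_mul_of_nonneg_right ?_ ?_)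
    · exact Real.rpow_le_rpow_of_nonpos hF' (by exact_mod_cast (by omega : F ≤ s)) (by linarith)
    · exact Finset.sum_nonneg fun l _ => by positivity
  refine (Finset.sum_le_sum h1).trans ?_
  rw [Finset.sum_add_distrib, ← Finset.sum_mul, ← Finset.mul_sum]
  unfold tailMajorant
  refine add_le_add ?_ (mul_le_mul_of_nonneg_left ?_ (by positivity))
  · have h2 := sum_Ico_rpow_le (q := p + 2) (by linarith) hF N
    rw [show p + 2 + 1 = p + 3 by ring] at h2
    refine (mul_le_mul_of_nonneg_right h2 (by positivity)).trans_eq ?_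
    rw [show -(2 * p + 2) = -(p + 2) + -p by ring, Real.rpow_add hF']
    ring
  · rw [Finset.sum_comm]
    refine Finset.sum_le_sum fun l hl => ?_
    rw [Finset.mem_Icc] at hl
    have hl0 : (0 : ℝ) < l := by exact_mod_cast hl.1
    rw [← Finset.sum_filter, Finset.sum_const, nsmul_eq_mul]
    -- For fixed `l`, `F < s ≤ n + l ≤ F + l` leaves at most `l` values of `s`, which turns `l^(-p)`
    -- into `l^(1-p)`.
    have hsub : {s ∈ Finset.Ico (F + 1) N | s ≤ n + l ∧ 2 * l ≤ F} ⊆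
        if F < n + l ∧ 2 * l ≤ F then Finset.Ico (F + 1) (F + 1 + l) else ∅ := by
      intro s hs
      simp only [Finset.mem_filter, Finset.mem_Ico] at hs
      rw [if_pos (by omega), Finset.mem_Ico]
      omega
    have hc := Finset.card_le_card hsub
    split_ifs at hc ⊢ with h
    · rw [Nat.card_Ico, Nat.add_sub_cancel_left] at hc
      rw [sub_eq_add_neg, Real.rpow_add hl0, Real.rpow_one]
      gcongr
    · rw [Finset.card_empty, Nat.le_zero] at hc
      simp [hc]

theorem sum_tailMajorant_le {p : ℝ} {F : ℕ} (hF : 0 < F) :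
    ∑ n ∈ Finset.range (F + 1), tailMajorant p F n / (n + 1) ≤
      4 * 2 ^ p * (F : ℝ) ^ (-(2 * p + 1)) +
        2 * ((F : ℝ) ^ (-(p + 4)) * ∑ l ∈ Finset.Icc 1 F, (l : ℝ) ^ (2 - p)) := by
  have hF' : (0 : ℝ) < F := by exact_mod_cast hF
  have hF1 : (1 : ℝ) ≤ F := by exact_mod_cast hF
  unfold tailMajorant
  simp_rw [add_div]
  rw [Finset.sum_add_distrib]
  refine add_le_add ?_ ?_
  · calc ∑ n ∈ Finset.range (F + 1),
          (2 * (n : ℝ) + 1) * 2 ^ p * (F : ℝ) ^ (-(2 * p + 2)) / (n + 1)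
        ≤ ∑ n ∈ Finset.range (F + 1), 2 * 2 ^ p * (F : ℝ) ^ (-(2 * p + 2)) := by
          refine Finset.sum_le_sum fun n _ => ?_
          rw [div_le_iff₀ (by positivity)]
          have : (0 : ℝ) < 2 ^ p * (F : ℝ) ^ (-(2 * p + 2)) := by positivity
          nlinarith
      _ = (F + 1) * (2 * 2 ^ p * (F : ℝ) ^ (-(2 * p + 2))) := by
          rw [Finset.sum_const, Finset.card_range, nsmul_eq_mul]
          push_cast
          rfl
      _ ≤ (2 * F) * (2 * 2 ^ p * (F : ℝ) ^ (-(2 * p + 2))) := by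
          gcongr
          linarith
      _ = 4 * 2 ^ p * (F : ℝ) ^ (-(2 * p + 1)) := by
          rw [show -(2 * p + 1) = -(2 * p + 2) + 1 by ring, Real.rpow_add hF', Real.rpow_one]
          ring
  · simp_rw [mul_div_assoc, Finset.sum_div]
    rw [← Finset.mul_sum, Finset.sum_comm]
    have h4 : (F : ℝ) ^ (-(p + 4)) = (F : ℝ) ^ (-(p + 3)) / F := by
      rw [show -(p + 4) = -(p + 3) - 1 by ring, Real.rpow_sub hF', Real.rpow_one]
    calc (F : ℝ) ^ (-(p + 3)) * ∑ l ∈ Finset.Icc 1 F, ∑ n ∈ Finset.range (F + 1),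
          (if F < n + l ∧ 2 * l ≤ F then (l : ℝ) ^ (1 - p) else 0) / ((n : ℝ) + 1)
        ≤ (F : ℝ) ^ (-(p + 3)) * ∑ l ∈ Finset.Icc 1 F, 2 / F * (l : ℝ) ^ (2 - p) := by
          refine mul_le_mul_of_nonneg_left (Finset.sum_le_sum fun l hl => ?_) (by positivity)
          rw [Finset.mem_Icc] at hl
          have hl0 : (0 : ℝ) < l := by exact_mod_cast hl.1
          have h1 : ∀ n ∈ Finset.range (F + 1),
              (if F < n + l ∧ 2 * l ≤ F then (l : ℝ) ^ (1 - p) else 0) / ((n : ℝ) + 1) ≤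
              if F < n + l then 2 / F * (l : ℝ) ^ (1 - p) else 0 := by
            intro n _
            by_cases ha : F < n + l
            · by_cases hb : 2 * l ≤ F
              · rw [if_pos ⟨ha, hb⟩, if_pos ha, div_le_iff₀ (by positivity)]
                -- Small `l` forces `n > F - l ≥ F/2`, so the weight `1/(n+1)` is at most `2/F`.
                have hn : (F : ℝ) ≤ 2 * (n + 1) := by exact_mod_cast (by omega : F ≤ 2 * (n + 1))
                have h2 : 1 ≤ 2 / (F : ℝ) * (n + 1) := by
                  rw [div_mul_eq_mul_div, le_div_iff₀ hF']
                  linarith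
                calc (l : ℝ) ^ (1 - p) = 1 * (l : ℝ) ^ (1 - p) := (one_mul _).symm
                  _ ≤ 2 / (F : ℝ) * (n + 1) * (l : ℝ) ^ (1 - p) := by gcongr
                  _ = _ := by ring
              · rw [if_neg fun h => hb h.2, if_pos ha, zero_div]
                positivity
            · rw [if_neg fun h => ha h.1, if_neg ha, zero_div]
          refine (Finset.sum_le_sum h1).trans ?_
          rw [← Finset.sum_filter, Finset.sum_const, nsmul_eq_mul]
          -- Again at most `l` values of `n` remain, which raises the power to `l^(2-p)`.
          have hsub : {n ∈ Finset.range (F + 1) | F < n + l} ⊆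
              Finset.Ico (F + 1 - l) (F + 1) := by
            intro n hn
            simp only [Finset.mem_filter, Finset.mem_range, Finset.mem_Ico] at hn ⊢
            omega
          have hc := Finset.card_le_card hsub
          rw [Nat.card_Ico, Nat.sub_sub_self (by omega)] at hc
          have h3 : (l : ℝ) ^ (2 - p) = l * (l : ℝ) ^ (1 - p) := by
            rw [show 2 - p = 1 + (1 - p) by ring, Real.rpow_add hl0, Real.rpow_one]
          rw [h3, mul_left_comm]
          gcongr
      _ = 2 * ((F : ℝ) ^ (-(p + 4)) * ∑ l ∈ Finset.Icc 1 F, (l : ℝ) ^ (2 - p)) := by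
          rw [← Finset.mul_sum, h4]
          field_simp

end Sums

/-! ### Error equation and the general error bound -/

section ErrorBound

variable {κ R : ℝ} {m ui u : ℝ → ℝ → ℂ}

theorem CoeffDecay.exists_nonneg {f : ℝ → ℝ → ℂ} {s : ℝ} (h : CoeffDecay R f s) :
    ∃ C : ℝ, 0 ≤ C ∧ ∀ n : ℕ, 1 ≤ n → ∀ ρ ∈ Icc (0 : ℝ) R,
      ‖coeff f n ρ‖ ≤ C * (n : ℝ) ^ (-s) := by
  obtain ⟨C, hC⟩ := h
  refine ⟨max C 0, le_max_right _ _, fun n hn ρ hρ => (hC n hn ρ hρ).trans ?_⟩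
  gcongr
  exact le_max_left _ _

theorem angInt_trunc (hm : BddMeas R m) (n F : ℕ) {ρ : ℝ} (hρ : ρ ∈ Icc 0 R) :
    angInt m (trunc F u) n ρ = ∑ s ∈ Finset.range (F + 1),
      coeff u s ρ * ∫ t in (-1 : ℝ)..1, (P s t : ℂ) * (m ρ t * (P n t : ℂ)) := by
  unfold angInt trunc
  simp_rw [← intervalIntegral.integral_const_mul]
  rw [← intervalIntegral.integral_finsetSum]
  · refine intervalIntegral.integral_congr fun t _ => ?_
    simp only [Finset.sum_mul]
    exact Finset.sum_congr rfl fun s _ => by ring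
  · intro s _
    exact (((bddMeas_P s).mul (hm.mul (bddMeas_P n))).intervalIntegrable hρ).const_mul _

/-- The decay exponent `p + 2 > 1` makes the coefficients of `u` summable, so the tail is the limit
of finite sums over `F < s < N`. The majorant bounds these uniformly in `N`; the extra `1/s` of the
triple integrals turns `p + 2` into `p + 3`. -/
theorem norm_angInt_sub_trunc_le (hm : BddMeas R m) (hu : BddMeas R u) {p Cm Cu : ℝ}
    (hp : 0 < p) (hCm : 0 ≤ Cm) (hCu : 0 ≤ Cu)
    (hmd : ∀ l : ℕ, 1 ≤ l → ∀ ρ ∈ Icc (0 : ℝ) R, ‖coeff m l ρ‖ ≤ Cm * (l : ℝ) ^ (-p))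
    (hud : ∀ s : ℕ, 1 ≤ s → ∀ ρ ∈ Icc (0 : ℝ) R, ‖coeff u s ρ‖ ≤ Cu * (s : ℝ) ^ (-(p + 2)))
    {F n : ℕ} (hF : 0 < F) (hn : n ≤ F) {ρ : ℝ} (hρ : ρ ∈ Icc 0 R) :
    ‖angInt m (fun ρ t => u ρ t - trunc F u ρ t) n ρ‖ ≤ 2 * Cu * Cm * tailMajorant p F n := by
  obtain ⟨A, -, hA⟩ := hu.exists_norm_le
  obtain ⟨B, -, hB⟩ := (hm.mul (bddMeas_P n)).exists_norm_le
  have hsum : Summable fun s => ‖coeff u s ρ‖ := by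
    refine Summable.of_norm_bounded_eventually_nat
      ((Real.summable_nat_rpow (p := -(p + 2))).mpr (by linarith) |>.mul_left Cu) ?_
    filter_upwards [eventually_ge_atTop 1] with s hs
    rw [norm_norm]
    exact hud s hs ρ hρ
  have h1 := (hasSum_integral_mul_of_summable_coeff (hu.measurable_apply ρ) (hA ρ hρ)
    ((hm.mul (bddMeas_P n)).measurable_apply ρ) (hB ρ hρ) (c := fun s => coeff u s ρ)
    (fun s => rfl) hsum).tendsto_sum_nat
  rw [angInt_sub hm hu (hu.trunc F) n hρ, angInt_trunc hm n F hρ]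
  have h2 : angInt m u n ρ = ∫ t in (-1 : ℝ)..1, u ρ t * (m ρ t * (P n t : ℂ)) := by
    unfold angInt
    simp only [mul_assoc]
  rw [h2]
  refine le_of_tendsto (h1.sub_const _).norm ?_
  filter_upwards [eventually_ge_atTop (F + 1)] with N hN
  rw [← Finset.sum_Ico_eq_sub _ hN]
  have h3 := sum_tail_le_tailMajorant hp hF hn N
  refine le_trans ?_ (mul_le_mul_of_nonneg_left h3 (by positivity : 0 ≤ 2 * Cu * Cm))
  rw [Finset.mul_sum]
  refine (norm_sum_le _ _).trans (Finset.sum_le_sum fun s hs => ?_)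
  rw [Finset.mem_Ico] at hs
  have hs0 : (0 : ℝ) < s := by exact_mod_cast (by omega : 0 < s)
  have h4 := norm_integral_P_mul_mul_P_le (hm.intervalIntegrable hρ)
    (b := fun l => Cm * (l : ℝ) ^ (-p)) (fun l hl => hmd l hl ρ hρ) (s := s) (n := n) (by omega)
  rw [norm_mul]
  refine (mul_le_mul (hud s (by omega) ρ hρ) h4 (norm_nonneg _) (by positivity)).trans_eq ?_
  rw [← Finset.mul_sum, show -(p + 3) = -(p + 2) - 1 by ring, Real.rpow_sub hs0, Real.rpow_one]
  ring

theorem opA_trunc_sub (hκ : 0 < κ) (hR : 0 < R) (hm : BddMeas R m)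
    (hu : IsExactSolution κ R m ui u) {F : ℕ} {v : ℝ → ℝ → ℂ}
    (hv : IsTruncatedSolution κ R m ui F v) {ρ t : ℝ} (hρ : ρ ∈ Icc 0 R)
    (ht : t ∈ Icc (-1 : ℝ) 1) :
    opA κ R m F (fun ρ t => trunc F u ρ t - v ρ t) ρ t =
      Complex.I / 2 * opK κ R m F (fun ρ t => u ρ t - trunc F u ρ t) ρ t := by
  have h1 : trunc F u ρ t = trunc F ui ρ t + Complex.I / 2 * opK κ R m F u ρ t := by
    unfold trunc opK
    rw [Finset.mul_sum, ← Finset.sum_add_distrib]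
    refine Finset.sum_congr rfl fun n _ => ?_
    rw [hu.2 n ρ hρ]
    ring
  have hK : ∀ w w' : ℝ → ℝ → ℂ, BddMeas R w → BddMeas R w' →
      opK κ R m F (fun ρ t => w ρ t - w' ρ t) ρ t = opK κ R m F w ρ t - opK κ R m F w' ρ t := by
    intro w w' hw hw'
    unfold opK
    rw [← Finset.sum_sub_distrib]
    refine Finset.sum_congr rfl fun n _ => ?_
    rw [opKn_sub hκ hR hm hw hw' n hρ, sub_mul]
  unfold opA
  rw [hK _ _ (hu.1.trunc F) hv.1, hK _ _ hu.1 (hu.1.trunc F)]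
  linear_combination h1 - hv.2 ρ hρ t ht

/-- The error of the truncated equation, in terms of the decay exponent of the contrast. -/
theorem exists_supNorm_error_le (hκ : 0 < κ) (hR : 0 < R) {v : ℕ → ℝ → ℝ → ℂ}
    (hm : BddMeas R m) (hu : IsExactSolution κ R m ui u) {B : ℝ≥0}
    (hB : ∀ F : ℕ, InvBound κ R m F B) (hv : ∀ F : ℕ, IsTruncatedSolution κ R m ui F (v F))
    {p : ℝ} (hp : 0 < p) (hmd : CoeffDecay R m p) (hud : CoeffDecay R u (p + 2)) :
    ∃ C : ℝ, 0 ≤ C ∧ ∀ F : ℕ, 0 < F →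
      supNorm R (fun ρ t => trunc F u ρ t - v F ρ t) ≤ ENNReal.ofReal (C *
        ((F : ℝ) ^ (-(2 * p + 1)) +
          (F : ℝ) ^ (-(p + 4)) * ∑ l ∈ Finset.Icc 1 F, (l : ℝ) ^ (2 - p))) := by
  obtain ⟨Cm, hCm, hmd⟩ := hmd.exists_nonneg
  obtain ⟨Cu, hCu, hud⟩ := hud.exists_nonneg
  have hk := kernelConst_nonneg (mul_pos hκ hR).le
  set K := 2 * κ ^ 2 * R ^ 2 * kernelConst (κ * R) * (2 * Cu * Cm) with hK
  have hK0 : 0 ≤ K := by positivity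
  -- `4 * 2 ^ p` and `2` are the two coefficients in `sum_tailMajorant_le`.
  refine ⟨B * (K * (4 * 2 ^ p + 2)), by positivity, fun F hF => ?_⟩
  have hF' : (0 : ℝ) < F := by exact_mod_cast hF
  set S := ∑ l ∈ Finset.Icc 1 F, (l : ℝ) ^ (2 - p) with hS
  have hS0 : 0 ≤ S := Finset.sum_nonneg fun l _ => by positivity
  refine ((hB F).2 _ ((hu.1.trunc F).sub (hv F).1)).trans ?_
  rw [mul_assoc, ENNReal.ofReal_mul B.coe_nonneg, ENNReal.ofReal_coe_nnreal]
  gcongr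
  refine supNorm_le_ofReal fun ρ hρ t ht => ?_
  rw [opA_trunc_sub hκ hR hm hu (hv F) hρ ht, norm_mul]
  have hI : ‖Complex.I / 2‖ ≤ 1 := by
    rw [norm_div, Complex.norm_I, Complex.norm_ofNat]
    norm_num
  have h1 : ‖opK κ R m F (fun ρ t => u ρ t - trunc F u ρ t) ρ t‖ ≤
      K * ∑ n ∈ Finset.range (F + 1), tailMajorant p F n / (n + 1) := by
    unfold opK
    rw [Finset.mul_sum]
    refine (norm_sum_le _ _).trans (Finset.sum_le_sum fun n hn => ?_)
    rw [norm_mul]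
    refine (mul_le_of_le_one_right (norm_nonneg _) (norm_P_le_one n ht)).trans ?_
    refine (norm_opKn_le hκ hR hρ fun ρ' hρ' => norm_angInt_sub_trunc_le hm hu.1 hp hCm hCu hmd hud
      hF (Nat.lt_succ_iff.mp (Finset.mem_range.mp hn)) hρ').trans_eq ?_
    rw [hK]
    ring
  refine (mul_le_of_le_one_left (norm_nonneg _) hI).trans (h1.trans ?_)
  rw [mul_assoc K]
  refine mul_le_mul_of_nonneg_left ((sum_tailMajorant_le hF).trans ?_) hK0
  have e1 : 0 < (F : ℝ) ^ (-(2 * p + 1)) := by positivity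
  have e2 : 0 ≤ (F : ℝ) ^ (-(p + 4)) * S := by positivity
  have e3 : (0 : ℝ) < 2 ^ p := by positivity
  nlinarith [mul_nonneg e3.le e2]

end ErrorBound

end AxiLS

end

/-! ### Convergence rates in the four cases -/

open AxiLS in
theorem mainTheorem1 (κ R : ℝ) (hκ : 0 < κ) (hR : 0 < R)
    (m ui u : ℝ → ℝ → ℂ) (v : ℕ → ℝ → ℝ → ℂ)
    (hm : AxiLS.BddMeas R m) (hui : AxiLS.BddMeas R ui)
    (hu : AxiLS.IsExactSolution κ R m ui u)
    (B : NNReal) (hB : ∀ F : ℕ, AxiLS.InvBound κ R m F B)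
    (hv : ∀ F : ℕ, AxiLS.IsTruncatedSolution κ R m ui F (v F))
    (k : ℕ) (α : ℝ) (hα : 0 < α) (hα1 : k ≤ 1 → α < 1)
    (hmdecay : AxiLS.CoeffDecay R m ((k : ℝ) + α))
    (hudecay : AxiLS.CoeffDecay R u ((k : ℝ) + 2 + α)) :
    (3 ≤ k → AxiLS.SupNormBigO R (fun F ρ t => AxiLS.trunc F u ρ t - v F ρ t)
      (fun F => (F : ℝ) ^ (-((k : ℝ) + 2.5 + α + min 1.5 ((k : ℝ) - 2 + α))))) ∧
    (k = 2 → AxiLS.SupNormBigO R (fun F ρ t => AxiLS.trunc F u ρ t - v F ρ t)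
      (fun F => Real.log (F : ℝ) * (F : ℝ) ^ (-(4.5 + α + min 1 (0.5 + α))))) ∧
    (k = 1 → AxiLS.SupNormBigO R (fun F ρ t => AxiLS.trunc F u ρ t - v F ρ t)
      (fun F => (F : ℝ) ^ (-(3 + 2 * α)))) ∧
    (k = 0 → AxiLS.SupNormBigO R (fun F ρ t => AxiLS.trunc F u ρ t - v F ρ t)
      (fun F => (F : ℝ) ^ (-(1 + 2 * α)))) := by
  have hk0 : (0 : ℝ) ≤ k := k.cast_nonneg
  have hp : 0 < (k : ℝ) + α := by linarith
  rw [show (k : ℝ) + 2 + α = k + α + 2 by ring] at hudecay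
  obtain ⟨C, hC, hmain⟩ := exists_supNorm_error_le hκ hR hm hu hB hv hp hmdecay hudecay
  -- a power bound for the remaining sum yields a power bound for the error
  have reduce : ∀ (D q e : ℝ), 0 ≤ D → q ≤ 2 * (k + α) + 1 → q ≤ k + α + 4 - e →
      (∀ F : ℕ, 0 < F → ∑ l ∈ Finset.Icc 1 F, (l : ℝ) ^ (2 - (k + α)) ≤ D * (F : ℝ) ^ e) →
      ∀ F : ℕ, 0 < F → supNorm R (fun ρ t => trunc F u ρ t - v F ρ t) ≤
        ENNReal.ofReal (C * (1 + D) * (F : ℝ) ^ (-q)) := by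
    intro D q e hD hq1 hq2 hsum F hF
    have hF1 : (1 : ℝ) ≤ F := by exact_mod_cast hF
    have hF' : (0 : ℝ) < F := by linarith
    refine (hmain F hF).trans (ENNReal.ofReal_le_ofReal ?_)
    rw [mul_assoc, add_mul, one_mul]
    refine mul_le_mul_of_nonneg_left (add_le_add ?_ ?_) hC
    · exact Real.rpow_le_rpow_of_exponent_le hF1 (by linarith)
    · calc (F : ℝ) ^ (-(k + α + 4)) * ∑ l ∈ Finset.Icc 1 F, (l : ℝ) ^ (2 - (k + α))
          ≤ (F : ℝ) ^ (-(k + α + 4)) * (D * (F : ℝ) ^ e) := by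
            gcongr
            exact hsum F hF
        _ = D * (F : ℝ) ^ (-(k + α + 4) + e) := by
            rw [Real.rpow_add hF']
            ring
        _ ≤ D * (F : ℝ) ^ (-q) := by
            refine mul_le_mul_of_nonneg_left ?_ hD
            exact Real.rpow_le_rpow_of_exponent_le hF1 (by linarith)
  have small : k ≤ 1 → ∀ F : ℕ → ℝ, (∀ n : ℕ, F n = (n : ℝ) ^ (-(2 * (k + α) + 1))) →
      SupNormBigO R (fun F ρ t => trunc F u ρ t - v F ρ t) F := by
    intro hk f hf
    have hα2 := hα1 hk
    have hk' : (k : ℝ) ≤ 1 := by exact_mod_cast hk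
    obtain ⟨D, hD, hsum⟩ := exists_sum_Icc_rpow_le (e := 2 - (k + α)) (by linarith)
    refine ⟨C * (1 + D), ?_⟩
    filter_upwards [eventually_gt_atTop 0] with F hF
    rw [hf]
    exact reduce D (2 * (k + α) + 1) _ hD le_rfl (by linarith) hsum F hF
  refine ⟨fun hk => ?_, fun hk => ?_, fun hk => ?_, fun hk => ?_⟩
  · have hk' : (3 : ℝ) ≤ k := by exact_mod_cast hk
    have hs : Summable fun l : ℕ => (l : ℝ) ^ (2 - (k + α)) :=
      Real.summable_nat_rpow.mpr (by linarith)
    refine ⟨C * (1 + ∑' l : ℕ, (l : ℝ) ^ (2 - (k + α))), ?_⟩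
    filter_upwards [eventually_gt_atTop 0] with F hF
    -- With `p = k + α` the required exponent is `min (p + 4) (2p + 1/2)`, below both exponents of
    -- the general bound.
    have hmin1 := min_le_left (1.5 : ℝ) ((k : ℝ) - 2 + α)
    have hmin2 := min_le_right (1.5 : ℝ) ((k : ℝ) - 2 + α)
    refine reduce _ _ 0 (tsum_nonneg fun l => by positivity) ?_ ?_ ?_ F hF
    · linarith
    · linarith
    · intro F _
      rw [Real.rpow_zero, mul_one]
      exact hs.sum_le_tsum _ fun l _ => by positivity
  · subst hk
    push_cast at reduce
    -- Replacing `l^(-α)` by `l^(-β)` keeps the exponent above `-1` for every `α`; the cap `1/2`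
    -- makes the resulting exponent `5 + α + β` equal to the required one.
    set β := min α (1 / 2) with hβ
    have hβ1 : β ≤ α := min_le_left _ _
    have hβ2 : β ≤ 1 / 2 := min_le_right _ _
    have hmin : min 1 (0.5 + α) = 1 / 2 + β := by
      rw [hβ, ← min_add_add_left, min_comm]
      norm_num
    obtain ⟨D, hD, hsum⟩ := exists_sum_Icc_rpow_le (e := -β) (by linarith)
    refine ⟨C * (1 + D), ?_⟩
    -- For `F ≥ 3 > e` the logarithm is at least 1, so inserting it only weakens the bound.
    filter_upwards [eventually_ge_atTop 3] with F hF
    refine (reduce D (4.5 + α + min 1 (0.5 + α)) (-β + 1) hD ?_ ?_ ?_ F (by omega)).trans ?_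
    · rw [hmin]
      linarith
    · rw [hmin]
      linarith
    · intro F hF
      refine le_trans (Finset.sum_le_sum fun l hl => ?_) (hsum F hF)
      exact Real.rpow_le_rpow_of_exponent_le (by exact_mod_cast (Finset.mem_Icc.mp hl).1)
        (by linarith)
    · have hlog : 1 ≤ Real.log F := by
        rw [Real.le_log_iff_exp_le (by positivity)]
        have h3 : (3 : ℝ) ≤ F := by exact_mod_cast hF
        linarith [Real.exp_one_lt_d9]
      refine ENNReal.ofReal_le_ofReal (mul_le_mul_of_nonneg_left ?_ (by positivity))
      exact le_mul_of_one_le_left (by positivity) hlog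
  · subst hk
    refine small le_rfl _ fun n => ?_
    congr 1
    push_cast
    ring
  · subst hk
    refine small zero_le_one _ fun n => ?_
    congr 1
    push_cast
    ring
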